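/- Fix integers $K,R\ge 0$. For each $n$ let $N=N_n$, $T=T_n$ with $N,T\to\infty$, let $\mathcal P=\mathcal P_n$ be a set of distributions $P$ of random $N\times T$ matrices $X,Z_1,\dots,Z_K,\Gamma,U$, let $\Theta=\Theta_n\subset\mathbb R\times\mathbb R^K$ be a set of parameters $\theta=(\beta,\delta)$, and let, under $\mathbb P_{\theta,P}$, $$Y=X\beta+\sum_{k=1}^K Z_k\delta_k+\Gamma+U .$$ Only $(Y,X,Z)$ is observed. **Notation.** $\langle\cdot,\cdot\rangle_F$, $\|\cdot\|_F$ are the Frobenius inner product and norm and $s_r(A)$ is the $r$-th largest singular value of $A$. For random quantities $A=A_n(\theta,P)$ and rates $r_n$, $A=\mathcal O_{\Theta,\mathcal P}(r_n)$ means that for all $\epsilon>0$ there is $C_\epsilon<\infty$ with $\limsup_n\sup_{P\in\mathcal P,\theta\in\Theta}\mathbb P_{P,\theta}(r_n^{-1}\|A\|\ge C_\epsilon)\le\epsilon$; $A=o_{\Theta,\mathcal P}(r_n)$ means that $\sup_{P,\theta}\mathbb P_{P,\theta}(r_n^{-1}\|A\|\ge\epsilon)\to0$ for all $\epsilon>0$;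 $A\asymp_{\Theta,\mathcal P}r_n$ means that $A=\mathcal O_{\Theta,\mathcal P}(r_n)$ and $A^{-1}=\mathcal O_{\Theta,\mathcal P}(r_n^{-1})$ (an inverse that does not exist has infinite norm). $A\to_dN(0,1)$ uniformly means that $\sup_{P,\theta}|\mathbb P_{P,\theta}(A\le t)-\Phi(t)|\to0$ for all $t$. Let $\operatorname{Lind}(A)=\max_{i,t}A_{it}^2/\sum_{i,t}A_{it}^2$. **Algorithm.** Let $c=c_{N,T}\in(0,\infty]$ be a given sequence and let $b^*=4R(\sqrt N+\sqrt T)$. Let $A^*=A^*(X,Z)$ minimize $\|A\|_F^2+(b^*)^2s_1(A)^2$ over the matrices $A\in\mathbb R^{N\times T}$ with $\operatorname{Lind}(A)\le c$, $\langle A,X\rangle_F=1$ and $\langle A,Z_k\rangle_F=0$ for all $k$. 1. $(\hat\beta_{\rm LS},\hat\delta_{\rm LS},\hat\Gamma_{\rm LS})$ minimizes $\|Y-X\beta-\sum_kZ_k\delta_k-G\|_F^2$ over $\beta\in\mathbb R$, $\delta\in\mathbb R^K$, $\operatorname{rank}G\le R$. 2. $\hat\beta_{\rm pre}=\langle A^*,Y-\hat\Gamma_{\rm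 LS}\rangle_F$, and $\hat\delta_{{\rm pre},j}$ is computed in the same way with the roles of $X$ and $Z_j$ switched. 3. $\hat\Gamma_{\rm pre}$ minimizes $\|Y-X\hat\beta_{\rm pre}-\sum_kZ_k\hat\delta_{{\rm pre},k}-G\|_F^2$ over $\operatorname{rank}G\le R$; let $\hat U_{\rm pre}=Y-X\hat\beta_{\rm pre}-\sum_kZ_k\hat\delta_{{\rm pre},k}-\hat\Gamma_{\rm pre}$. 4. $\hat\beta=\langle A^*,Y-\hat\Gamma_{\rm pre}\rangle_F$; for $\varepsilon>0$, $\hat C=4R\,s_1(\hat U_{\rm pre})(1+\varepsilon)$ and $\overline{\operatorname{bias}}_{\hat C}(\hat\beta)=\hat C s_1(A^*)$; the algorithm's standard error is $\widehat{\rm se}=\bigl(\sum_{i,t}(A^*_{it})^2\hat U_{{\rm pre},it}^2\bigr)^{1/2}$. All minimizers may be chosen by arbitrary measurable rules; where the weight problem is infeasible, or the minimum in step 1 is not attained, the output of the rule is arbitrary. **Assumption 1.** $\operatorname{rank}\Gamma\le R$ $P$-a.s. for all $P\in\mathcal P$, and: (i) there is $\underline s^2>0$ such that, with probability approaching 1 uniformly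 over $P\in\mathcal P$, $\min_{(b,d)\in\mathbb R^{K+1}:\,\|(b,d)\|=1}\frac1{NT}\sum_{r=2R+1}^{\min\{N,T\}}s_r^2(Xb+\sum_kZ_kd_k)\ge\underline s^2$; (ii) $s_1(X)$ and all $s_1(Z_k)$ are $\mathcal O_{\Theta,\mathcal P}(\sqrt{NT})$, and $s_1(U)\asymp_{\Theta,\mathcal P}\max\{\sqrt N,\sqrt T\}$; (iii) $\langle X,U\rangle_F$ and all $\langle Z_k,U\rangle_F$ are $\mathcal O_{\Theta,\mathcal P}(\sqrt{NT})$; (iv) $(s_1(U)-s_r(U))/s_1(U)=o_{\Theta,\mathcal P}(1)$ for each fixed integer $r\ge1$; (v) $\langle A,U\rangle_F=\mathcal O_{\Theta,\mathcal P}(\|A\|_F)$ for every sequence of (measurable) matrix functions $A=A_{N,T}(X,Z)$. **Assumption 2** (for $X$, $Z_1,\dots,Z_K$ and the sequence $c$). For all $P\in\mathcal P$ there are $\pi=\pi_P\in\mathbb R^K$ and random matrices $H,V$ with $X=\sum_kZ_k\pi_k+H+V$ such that: (i) $\|V\|_F\asymp_{\Theta,\mathcal P}\sqrt{NT}$ and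 $s_1(V)=\mathcal O_{\Theta,\mathcal P}(\max\{\sqrt N,\sqrt T\})$; (ii) $\|H\|_F=\mathcal O_{\Theta,\mathcal P}(\sqrt{NT})$ and $\langle H,V\rangle_F=\mathcal O_{\Theta,\mathcal P}(\sqrt{NT})$; (iii) $\|Z_k\|_F=\mathcal O_{\Theta,\mathcal P}(\sqrt{NT})$ and $\langle Z_k,V\rangle_F=\mathcal O_{\Theta,\mathcal P}(\sqrt{NT})$ for all $k$; (iv) $(\mathbf Z'\mathbf Z)^{-1}=\mathcal O_{\Theta,\mathcal P}(1/(NT))$, where $\mathbf Z=[\operatorname{vec}(Z_1),\dots,\operatorname{vec}(Z_K)]$; (v) $\max_{i,t}V_{it}^2=o_{\Theta,\mathcal P}(NTc)$ and $\max_{i,t}Z_{k,it}^2=o_{\Theta,\mathcal P}((NT)^2c)$ for all $k$. **Theorem.** Suppose that Assumption 1 holds, and that Assumption 2 holds as stated and with $Z_k$ and $X$ interchanged for each $k=1,\dots,K$. Then $$\hat\beta-\beta=\mathcal O_{\Theta,\mathcal P}(1/\min\{N,T\}).$$ If, in addition, $\langle A^*,U\rangle_F/\widehat{\rm se}\to_dN(0,1)$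 uniformly over $\Theta,\mathcal P$, where $\widehat{\rm se}$ is the algorithm's standard error or any other nonnegative measurable function of $(Y,X,Z)$, then for all $\varepsilon>0$ and $\alpha\in(0,1)$ $$\liminf_n\inf_{\theta\in\Theta,P\in\mathcal P}\mathbb P_{\theta,P}\Bigl(\beta\in\bigl\{\hat\beta\pm[\overline{\operatorname{bias}}_{\hat C}(\hat\beta)+z_{1-\alpha/2}\widehat{\rm se}]\bigr\}\Bigr)\ge1-\alpha,$$ where $z_p$ is the $p$-quantile of $N(0,1)$. -/

import Mathlib

open MeasureTheory ProbabilityTheory Filter Topology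
open scoped ENNReal NNReal

noncomputable section

namespace FactorPanel

/-- Real `N × T` matrices. -/
abbrev Mat (N T : ℕ) : Type := Matrix (Fin N) (Fin T) ℝ

/-- The product (equivalently, Borel) σ-algebra on real matrices. -/
instance instMeasurableSpaceMatrix {m n : Type*} : MeasurableSpace (Matrix m n ℝ) :=
  inferInstanceAs (MeasurableSpace (m → n → ℝ))

/-! ### Matrix quantities -/

/-- The entrywise (Frobenius) inner product `⟨A, B⟩_F`. -/
def frobInner {m n : Type*} [Fintype m] [Fintype n] (A B : Matrix m n ℝ) : ℝ :=
  ∑ i, ∑ t, A i t * B i t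

/-- The Frobenius norm `‖A‖_F`. -/
def frobNorm {m n : Type*} [Fintype m] [Fintype n] (A : Matrix m n ℝ) : ℝ :=
  √(frobInner A A)

/-- The `r`-th largest singular value `s_r(A)`, for `r = 1, 2, …` (zero beyond `min {N, T}`). -/
def sv {N T : ℕ} (A : Mat N T) (r : ℕ) : ℝ :=
  (Matrix.toEuclideanLin A).singularValues (r - 1)

/-- `max_{i,t} A_{it}²`. -/
def maxSq {N T : ℕ} (A : Mat N T) : ℝ := ⨆ i, ⨆ t, A i t ^ 2

/-- `Lind(A) = max_{i,t} A_{it}² / ∑_{i,t} A_{it}²`. -/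
def lind {N T : ℕ} (A : Mat N T) : ℝ := maxSq A / ∑ i, ∑ t, A i t ^ 2

/-- `W · γ = X b + ∑_k Z_k d_k` for `γ = (b, d)`. -/
def lin {N T K : ℕ} (X : Mat N T) (Z : Fin K → Mat N T) (g : ℝ × (Fin K → ℝ)) : Mat N T :=
  g.1 • X + ∑ k, g.2 k • Z k

/-- The `K × K` matrix `𝐙'𝐙`, where `𝐙 = [vec Z_1, …, vec Z_K]`. -/
def gram {N T K : ℕ} (Z : Fin K → Mat N T) : Matrix (Fin K) (Fin K) ℝ :=
  Matrix.of fun j k => frobInner (Z j) (Z k)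

/-- The norm of `(𝐙'𝐙)⁻¹`, which is infinite if `𝐙'𝐙` is singular. -/
def gramInvNorm {N T K : ℕ} (Z : Fin K → Mat N T) : ℝ≥0∞ :=
  open Classical in
  if IsUnit (gram Z).det then ENNReal.ofReal (frobNorm (gram Z)⁻¹) else ⊤

/-! ### The estimation algorithm -/

/-- The constraints of the weight problem: `Lind(A) ≤ c` (void for `c = ∞`), `⟨A, X⟩_F = 1` and
`⟨A, Z_k⟩_F = 0` for all `k`. -/
def Feasible {N T K : ℕ} (c : ℝ≥0∞) (X : Mat N T) (Z : Fin K → Mat N T) (A : Mat N T) : Prop :=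
  ENNReal.ofReal (lind A) ≤ c ∧ frobInner A X = 1 ∧ ∀ k, frobInner A (Z k) = 0

/-- The objective `‖A‖_F² + b² s_1(A)²` of the weight problem. -/
def weightObj {N T : ℕ} (b : ℝ) (A : Mat N T) : ℝ := frobNorm A ^ 2 + b ^ 2 * sv A 1 ^ 2

/-- `A` is a solution `A^*_{b,c}` of the weight problem. -/
def IsOptimalWeight {N T K : ℕ} (b : ℝ) (c : ℝ≥0∞) (X : Mat N T) (Z : Fin K → Mat N T)
    (A : Mat N T) : Prop :=
  Feasible c X Z A ∧ ∀ B, Feasible c X Z B → weightObj b A ≤ weightObj b B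

/-- The default tuning parameter `b^* = 4R(√N + √T)`. -/
def bStar (N T R : ℕ) : ℝ := 4 * R * (√N + √T)

/-- `p = (β, δ, G)` solves the least squares problem with `rank G ≤ R`. -/
def IsLeastSquares {N T K : ℕ} (R : ℕ) (Y X : Mat N T) (Z : Fin K → Mat N T)
    (p : (ℝ × (Fin K → ℝ)) × Mat N T) : Prop :=
  p.2.rank ≤ R ∧ ∀ q : (ℝ × (Fin K → ℝ)) × Mat N T, q.2.rank ≤ R →
    ∑ i, ∑ t, (Y - lin X Z p.1 - p.2) i t ^ 2 ≤ ∑ i, ∑ t, (Y - lin X Z q.1 - q.2) i t ^ 2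

/-- `G` is a best approximation of `E` among the matrices of rank at most `R`. -/
def IsLowRankFit {N T : ℕ} (R : ℕ) (E G : Mat N T) : Prop :=
  G.rank ≤ R ∧ ∀ G' : Mat N T, G'.rank ≤ R →
    ∑ i, ∑ t, (E - G) i t ^ 2 ≤ ∑ i, ∑ t, (E - G') i t ^ 2

/-- An implementation of the algorithm for given `N, T, K, R` and Lindeberg bound `c`: a
(measurable) way of picking a solution in each of its three minimization problems. The weight
problem may be infeasible, and the least squares problem may fail to attain its infimum; for such
data, nothing is required of the pick. -/
structure Implementation (N T K R : ℕ) (c : ℝ≥0∞) where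
  /-- `weight X Z` is the weight matrix `A^*_{b^*,c}` -/
  weight : Mat N T → (Fin K → Mat N T) → Mat N T
  measurable_weight : Measurable fun d : Mat N T × (Fin K → Mat N T) => weight d.1 d.2
  weight_optimal : ∀ X Z, (∃ A, Feasible c X Z A) →
    IsOptimalWeight (bStar N T R) c X Z (weight X Z)
  /-- `ls Y X Z` is the least squares estimate of `((β, δ), Γ)` -/
  ls : Mat N T → Mat N T → (Fin K → Mat N T) → (ℝ × (Fin K → ℝ)) × Mat N T
  measurable_ls :
    Measurable fun d : Mat N T × Mat N T × (Fin K → Mat N T) => ls d.1 d.2.1 d.2.2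
  ls_optimal : ∀ Y X Z, (∃ p, IsLeastSquares R Y X Z p) → IsLeastSquares R Y X Z (ls Y X Z)
  /-- `lowRank E` is given by the leading `R` principal components of `E` -/
  lowRank : Mat N T → Mat N T
  measurable_lowRank : Measurable lowRank
  lowRank_optimal : ∀ E, IsLowRankFit R E (lowRank E)

namespace Implementation

variable {N T K R : ℕ} {c : ℝ≥0∞} (I : Implementation N T K R c)

/-- `Γ̂_LS` -/
def gammaLS (Y X : Mat N T) (Z : Fin K → Mat N T) : Mat N T := (I.ls Y X Z).2

/-- `β̂_pre = ⟨A^*, Y - Γ̂_LS⟩_F`, and `δ̂_{pre,j}`, computed in the same way with `X` and `Z_j`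
switched. -/
def coefPre (Y X : Mat N T) (Z : Fin K → Mat N T) : ℝ × (Fin K → ℝ) :=
  (frobInner (I.weight X Z) (Y - I.gammaLS Y X Z),
    fun j => frobInner (I.weight (Z j) (Function.update Z j X)) (Y - I.gammaLS Y X Z))

/-- `Γ̂_pre` -/
def gammaPre (Y X : Mat N T) (Z : Fin K → Mat N T) : Mat N T :=
  I.lowRank (Y - lin X Z (I.coefPre Y X Z))

/-- `Û_pre = Y - X β̂_pre - Z · δ̂_pre - Γ̂_pre` -/
def residPre (Y X : Mat N T) (Z : Fin K → Mat N T) : Mat N T :=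
  Y - lin X Z (I.coefPre Y X Z) - I.gammaPre Y X Z

/-- The final estimate `β̂ = ⟨A^*, Y - Γ̂_pre⟩_F`. -/
def betaHat (Y X : Mat N T) (Z : Fin K → Mat N T) : ℝ :=
  frobInner (I.weight X Z) (Y - I.gammaPre Y X Z)

/-- `Ĉ = 4 R s_1(Û_pre) (1 + ε)` -/
def cHat (ε : ℝ) (Y X : Mat N T) (Z : Fin K → Mat N T) : ℝ :=
  4 * R * sv (I.residPre Y X Z) 1 * (1 + ε)

/-- The worst-case bias `Ĉ s_1(A^*)` of `β̂`. -/
def biasBar (ε : ℝ) (Y X : Mat N T) (Z : Fin K → Mat N T) : ℝ :=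
  I.cHat ε Y X Z * sv (I.weight X Z) 1

/-- The standard error `(∑_{i,t} (A^*_{it})² (Û_{pre,it})²)^{1/2}`. -/
def se (Y X : Mat N T) (Z : Fin K → Mat N T) : ℝ :=
  √(∑ i, ∑ t, I.weight X Z i t ^ 2 * I.residPre Y X Z i t ^ 2)

end Implementation

/-- The standard normal quantile `z_p`. -/
def normalQuantile (p : ℝ) : ℝ := sInf {x : ℝ | p ≤ cdf (gaussianReal 0 1) x}

/-! ### Sequences of models and uniform asymptotics -/

/-- A sequence (indexed by `n`) of panel models with `K` controls: dimensions `N_n, T_n → ∞`,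
random matrices `X, Z_1, …, Z_K, Γ, U`, a set `𝒫_n` of distributions (probability measures on the
sample space) and a set `Θ_n` of parameters `θ = (β, δ)`. -/
structure PanelSeq (K : ℕ) where
  N : ℕ → ℕ
  T : ℕ → ℕ
  tendsto_N : Tendsto N atTop atTop
  tendsto_T : Tendsto T atTop atTop
  Ω : ℕ → Type*
  [measurableSpace : ∀ n, MeasurableSpace (Ω n)]
  X : ∀ n, Ω n → Mat (N n) (T n)
  Z : ∀ n, Ω n → Fin K → Mat (N n) (T n)
  Gam : ∀ n, Ω n → Mat (N n) (T n)
  U : ∀ n, Ω n → Mat (N n) (T n)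
  measurable_X : ∀ n, Measurable (X n)
  measurable_Z : ∀ n, Measurable (Z n)
  measurable_Gam : ∀ n, Measurable (Gam n)
  measurable_U : ∀ n, Measurable (U n)
  /-- the sets `𝒫_n` -/
  Pr : ∀ n, Set (ProbabilityMeasure (Ω n))
  /-- the sets `Θ_n` -/
  Par : ℕ → Set (ℝ × (Fin K → ℝ))

attribute [instance] PanelSeq.measurableSpace

namespace PanelSeq

variable {K : ℕ} (M : PanelSeq K)

/-- The outcome `Y = X β + Z · δ + Γ + U` under `θ = (β, δ)`. -/
def Y (n : ℕ) (θ : ℝ × (Fin K → ℝ)) (ω : M.Ω n) : Mat (M.N n) (M.T n) :=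
  lin (M.X n ω) (M.Z n ω) θ + M.Gam n ω + M.U n ω

/-- `sup_{P ∈ 𝒫_n, θ ∈ Θ_n} ℙ_{P,θ}(E)` -/
def supProb (n : ℕ)
    (E : ProbabilityMeasure (M.Ω n) → ℝ × (Fin K → ℝ) → Set (M.Ω n)) : ℝ≥0∞ :=
  ⨆ P ∈ M.Pr n, ⨆ θ ∈ M.Par n, (P : Measure (M.Ω n)) (E P θ)

/-- `inf_{P ∈ 𝒫_n, θ ∈ Θ_n} ℙ_{P,θ}(E)` -/
def infProb (n : ℕ)
    (E : ProbabilityMeasure (M.Ω n) → ℝ × (Fin K → ℝ) → Set (M.Ω n)) : ℝ≥0∞ :=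
  ⨅ P ∈ M.Pr n, ⨅ θ ∈ M.Par n, (P : Measure (M.Ω n)) (E P θ)

/-- `A = 𝒪_{Θ,𝒫}(r)`, for the norm `A` of a random quantity that may depend on `P` and `θ`. -/
def BigO (A : ∀ n, ProbabilityMeasure (M.Ω n) → ℝ × (Fin K → ℝ) → M.Ω n → ℝ≥0∞)
    (r : ℕ → ℝ≥0∞) : Prop :=
  ∀ ε : ℝ≥0, 0 < ε → ∃ C : ℝ≥0,
    limsup (fun n => M.supProb n fun P θ => {ω | (C : ℝ≥0∞) ≤ (r n)⁻¹ * A n P θ ω}) atTop ≤ ε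

/-- `A = o_{Θ,𝒫}(r)` -/
def LittleO (A : ∀ n, ProbabilityMeasure (M.Ω n) → ℝ × (Fin K → ℝ) → M.Ω n → ℝ≥0∞)
    (r : ℕ → ℝ≥0∞) : Prop :=
  ∀ ε : ℝ≥0, 0 < ε →
    Tendsto (fun n => M.supProb n fun P θ => {ω | (ε : ℝ≥0∞) ≤ (r n)⁻¹ * A n P θ ω}) atTop (𝓝 0)

/-- `A ≍_{Θ,𝒫} r`; here `A⁻¹ = ∞` where `A = 0`. -/
def Asymp (A : ∀ n, ProbabilityMeasure (M.Ω n) → ℝ × (Fin K → ℝ) → M.Ω n → ℝ≥0∞)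
    (r : ℕ → ℝ≥0∞) : Prop :=
  M.BigO A r ∧ M.BigO (fun n P θ ω => (A n P θ ω)⁻¹) fun n => (r n)⁻¹

/-- Uniform convergence in distribution to `N(0,1)`:
`sup_{P ∈ 𝒫, θ ∈ Θ} |ℙ_{P,θ}(A ≤ t) - Φ(t)| → 0` for all `t`. -/
def TendstoNormal (A : ∀ n, ℝ × (Fin K → ℝ) → M.Ω n → ℝ) : Prop :=
  ∀ t : ℝ, Tendsto (fun n => ⨆ P ∈ M.Pr n, ⨆ θ ∈ M.Par n,
    ENNReal.ofReal |(P : Measure (M.Ω n)).real {ω | A n θ ω ≤ t} - cdf (gaussianReal 0 1) t|)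
    atTop (𝓝 0)

/-- The rate `√(NT)`. -/
def rootNT (n : ℕ) : ℝ≥0∞ := ENNReal.ofReal √((M.N n : ℝ) * M.T n)

/-- The rate `NT`. -/
def prodNT (n : ℕ) : ℝ≥0∞ := (M.N n : ℝ≥0∞) * M.T n

/-- The rate `max {√N, √T}`. -/
def maxRoot (n : ℕ) : ℝ≥0∞ := ENNReal.ofReal (max √(M.N n : ℝ) √(M.T n : ℝ))

/-- The factor model assumption. -/
structure FactorModel (R : ℕ) : Prop where
  rank_le : ∀ n, ∀ P ∈ M.Pr n, ∀ᵐ ω ∂(P : Measure (M.Ω n)), (M.Gam n ω).rank ≤ R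
  /-- generalized non-collinearity, with probability approaching one uniformly -/
  nonCollinear : ∃ s : ℝ, 0 < s ∧
    Tendsto (fun n => ⨆ P ∈ M.Pr n, (P : Measure (M.Ω n))
      {ω | ¬ ∀ g : ℝ × (Fin K → ℝ), g.1 ^ 2 + ∑ k, g.2 k ^ 2 = 1 →
        s ≤ 1 / ((M.N n : ℝ) * M.T n) *
          ∑ r ∈ Finset.Icc (2 * R + 1) (min (M.N n) (M.T n)),
            sv (lin (M.X n ω) (M.Z n ω) g) r ^ 2}) atTop (𝓝 0)
  /-- spectral norms -/
  sn_X : M.BigO (fun n _ _ ω => ‖sv (M.X n ω) 1‖ₑ) M.rootNT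
  sn_Z : ∀ k, M.BigO (fun n _ _ ω => ‖sv (M.Z n ω k) 1‖ₑ) M.rootNT
  sn_U : M.Asymp (fun n _ _ ω => ‖sv (M.U n ω) 1‖ₑ) M.maxRoot
  /-- exogeneity -/
  ex_X : M.BigO (fun n _ _ ω => ‖frobInner (M.X n ω) (M.U n ω)‖ₑ) M.rootNT
  ex_Z : ∀ k, M.BigO (fun n _ _ ω => ‖frobInner (M.Z n ω k) (M.U n ω)‖ₑ) M.rootNT
  /-- leading singular values of the noise -/
  sv_U : ∀ r : ℕ, 1 ≤ r →
    M.LittleO (fun n _ _ ω => ‖(sv (M.U n ω) 1 - sv (M.U n ω) r) / sv (M.U n ω) 1‖ₑ) 1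
  /-- `⟨A, U⟩_F = 𝒪(‖A‖_F)` for every sequence of matrices `A = A(X, Z)` -/
  inner_U : ∀ A : ∀ n, Mat (M.N n) (M.T n) → (Fin K → Mat (M.N n) (M.T n)) →
      Mat (M.N n) (M.T n),
    (∀ n, Measurable fun d : Mat (M.N n) (M.T n) × (Fin K → Mat (M.N n) (M.T n)) =>
      A n d.1 d.2) →
    M.BigO (fun n _ _ ω => ‖frobInner (A n (M.X n ω) (M.Z n ω)) (M.U n ω) /
      frobNorm (A n (M.X n ω) (M.Z n ω))‖ₑ) 1

/-- The conditions on a decomposition `X = Z · π + H + V`, for given `π`, `H` and `V`. The random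
matrices `X` and `Z` are arguments here, so that their roles can be interchanged. -/
structure DecompositionWith (c : ℕ → ℝ≥0∞)
    (X : ∀ n, M.Ω n → Mat (M.N n) (M.T n)) (Z : ∀ n, M.Ω n → Fin K → Mat (M.N n) (M.T n))
    (π : ∀ n, ProbabilityMeasure (M.Ω n) → Fin K → ℝ)
    (H V : ∀ n, ProbabilityMeasure (M.Ω n) → M.Ω n → Mat (M.N n) (M.T n)) : Prop where
  measurable_H : ∀ n, ∀ P ∈ M.Pr n, Measurable (H n P)
  measurable_V : ∀ n, ∀ P ∈ M.Pr n, Measurable (V n P)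
  decomp : ∀ n, ∀ P ∈ M.Pr n, ∀ᵐ ω ∂(P : Measure (M.Ω n)),
    X n ω = ∑ k, π n P k • Z n ω k + H n P ω + V n P ω
  norm_V : M.Asymp (fun n P _ ω => ‖frobNorm (V n P ω)‖ₑ) M.rootNT
  sn_V : M.BigO (fun n P _ ω => ‖sv (V n P ω) 1‖ₑ) M.maxRoot
  norm_H : M.BigO (fun n P _ ω => ‖frobNorm (H n P ω)‖ₑ) M.rootNT
  inner_H_V : M.BigO (fun n P _ ω => ‖frobInner (H n P ω) (V n P ω)‖ₑ) M.rootNT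
  norm_Z : ∀ k, M.BigO (fun n _ _ ω => ‖frobNorm (Z n ω k)‖ₑ) M.rootNT
  inner_Z_V : ∀ k, M.BigO (fun n P _ ω => ‖frobInner (Z n ω k) (V n P ω)‖ₑ) M.rootNT
  gram_inv : M.BigO (fun n _ _ ω => gramInvNorm (Z n ω)) fun n => (M.prodNT n)⁻¹
  max_V : M.LittleO (fun n P _ ω => ‖maxSq (V n P ω)‖ₑ) fun n => M.prodNT n * c n
  max_Z : ∀ k, M.LittleO (fun n _ _ ω => ‖maxSq (Z n ω k)‖ₑ) fun n => M.prodNT n ^ 2 * c n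

/-- The decomposition assumption for a regressor `X` given controls `Z`. -/
def Decomposition (c : ℕ → ℝ≥0∞)
    (X : ∀ n, M.Ω n → Mat (M.N n) (M.T n))
    (Z : ∀ n, M.Ω n → Fin K → Mat (M.N n) (M.T n)) : Prop :=
  ∃ (π : ∀ n, ProbabilityMeasure (M.Ω n) → Fin K → ℝ)
    (H V : ∀ n, ProbabilityMeasure (M.Ω n) → M.Ω n → Mat (M.N n) (M.T n)),
    M.DecompositionWith c X Z π H V

/-- Uniform asymptotic validity of the bias-aware confidence interval
`β̂ ± [Ĉ s_1(A^*) + z_{1-α/2} se]` with standard error `se` (a function of the data). -/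
def ValidCI {R : ℕ} {c : ℕ → ℝ≥0∞}
    (I : ∀ n, Implementation (M.N n) (M.T n) K R (c n)) (ε α : ℝ)
    (se : ∀ n, Mat (M.N n) (M.T n) → Mat (M.N n) (M.T n) → (Fin K → Mat (M.N n) (M.T n)) → ℝ) :
    Prop :=
  ENNReal.ofReal (1 - α) ≤ liminf (fun n => M.infProb n fun _ θ => {ω |
    θ.1 ∈ Set.Icc
      ((I n).betaHat (M.Y n θ ω) (M.X n ω) (M.Z n ω) -
        ((I n).biasBar ε (M.Y n θ ω) (M.X n ω) (M.Z n ω) +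
          normalQuantile (1 - α / 2) * se n (M.Y n θ ω) (M.X n ω) (M.Z n ω)))
      ((I n).betaHat (M.Y n θ ω) (M.X n ω) (M.Z n ω) +
        ((I n).biasBar ε (M.Y n θ ω) (M.X n ω) (M.Z n ω) +
          normalQuantile (1 - α / 2) * se n (M.Y n θ ω) (M.X n ω) (M.Z n ω)))}) atTop

/-- Uniform asymptotic normality of `⟨A^*, U⟩_F / se`. -/
def NoiseNormal {R : ℕ} {c : ℕ → ℝ≥0∞}
    (I : ∀ n, Implementation (M.N n) (M.T n) K R (c n))
    (se : ∀ n, Mat (M.N n) (M.T n) → Mat (M.N n) (M.T n) → (Fin K → Mat (M.N n) (M.T n)) → ℝ) :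
    Prop :=
  M.TendstoNormal fun n θ ω =>
    frobInner ((I n).weight (M.X n ω) (M.Z n ω)) (M.U n ω) /
      se n (M.Y n θ ω) (M.X n ω) (M.Z n ω)

end PanelSeq

end FactorPanel

end

/-! Because A* = `weight X Z` satisfies ⟨A*, X⟩ = 1 and ⟨A*, Z_k⟩ = 0, the error splits exactly as
β̂ - β = ⟨A*, Γ - Γ̂_pre⟩ + ⟨A*, U⟩. The first term is a bias. The matrix Γ - Γ̂_pre has rank at
most 2R, so duality of spectral and nuclear norms bounds the bias by s_1(A*) √(2R) ‖Γ - Γ̂_pre‖_F.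
Moreover Γ̂_pre is a best rank-R fit to Γ + (U + Δ), where Δ collects the fitted values of the
preliminary coefficient errors, so ‖Γ - Γ̂_pre‖_F ≤ 2√(2R) s_1(U + Δ). Hence |bias| ≤ 4R (s_1(U) +
‖Δ‖_F) s_1(A*), see `abs_betaHat_error_sub_noise_le`.

Rate: the residual of V on the controls, rescaled, is a feasible weight with Frobenius norm of order
1/√(NT) and spectral norm of order max{√N,√T}/(NT) (`DecompBound.exists_feasible`). Comparing
objectives, ‖A*‖_F and R max{√N,√T} s_1(A*) are of order 1/min{N,T} (`IsOptimalWeight.norm_le`).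
Non-collinearity and exogeneity give ‖Γ - Γ̂_LS‖_F of order max{√N,√T}
(`IsLeastSquares.frobNorm_error_le`), so the preliminary coefficients err by order 1/min{N,T}, and
‖Δ‖_F is negligible against s_1(U).

Coverage: Û_pre is U + Δ plus a matrix of rank at most 2R, so s_1(Û_pre) ≥ s_{2R+1}(U) - ‖Δ‖_F,
which is close to s_1(U) by the assumption on the leading singular values. The factor 1 + ε absorbs
the difference, and the reported worst-case bias dominates the true one with high probability
(`FactorModel.tight_betaHat`). Off a small event the interval then covers β whenever |⟨A*, U⟩| ≤ z
se, and normality finishes (`le_real_of_ratio_near_normal`).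

The bounds are deterministic given finitely many inequalities (`ModelBound`, `DecompBound`,
`WeightBound`); probability enters through `Tight`, which says that such inequalities hold with high
probability for large constants. -/

namespace FactorPanel

/-! ### Frobenius geometry of matrices. -/

section Frobenius

variable {m n : Type*} [Fintype m] [Fintype n]

/-- A matrix as a vector of the Euclidean space of all its entries. -/
noncomputable def vec (A : Matrix m n ℝ) : EuclideanSpace ℝ (m × n) :=
  WithLp.toLp 2 fun p => A p.1 p.2

lemma vec_add {m n : Type*} (A B : Matrix m n ℝ) : vec (A + B) = vec A + vec B := rfl

lemma vec_smul {m n : Type*} (a : ℝ) (A : Matrix m n ℝ) : vec (a • A) = a • vec A := rfl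

lemma frobInner_eq_inner (A B : Matrix m n ℝ) : frobInner A B = inner ℝ (vec A) (vec B) := by
  simp [frobInner, vec, PiLp.inner_apply, Fintype.sum_prod_type, mul_comm]

lemma frobNorm_eq_norm (A : Matrix m n ℝ) : frobNorm A = ‖vec A‖ := by
  rw [frobNorm, frobInner_eq_inner, real_inner_self_eq_norm_sq, Real.sqrt_sq (norm_nonneg _)]

lemma frobNorm_nonneg (A : Matrix m n ℝ) : 0 ≤ frobNorm A := Real.sqrt_nonneg _

lemma frobInner_self (A : Matrix m n ℝ) : frobInner A A = frobNorm A ^ 2 := by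
  rw [frobNorm_eq_norm, frobInner_eq_inner, real_inner_self_eq_norm_sq]

lemma sum_sq_eq_frobNorm_sq (A : Matrix m n ℝ) : ∑ i, ∑ t, A i t ^ 2 = frobNorm A ^ 2 := by
  rw [← frobInner_self]
  simp [frobInner, sq]

lemma frobInner_comm (A B : Matrix m n ℝ) : frobInner A B = frobInner B A := by
  simp [frobInner, mul_comm]

lemma frobInner_add_right (A B C : Matrix m n ℝ) :
    frobInner A (B + C) = frobInner A B + frobInner A C := by
  simp [frobInner_eq_inner, vec_add, inner_add_right]

lemma frobInner_smul_right (a : ℝ) (A B : Matrix m n ℝ) :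
    frobInner A (a • B) = a * frobInner A B := by
  simp [frobInner_eq_inner, vec_smul, inner_smul_right]

lemma frobInner_neg_right (A B : Matrix m n ℝ) : frobInner A (-B) = -frobInner A B := by
  simpa using frobInner_smul_right (-1) A B

lemma frobInner_sub_right (A B C : Matrix m n ℝ) :
    frobInner A (B - C) = frobInner A B - frobInner A C := by
  rw [sub_eq_add_neg, frobInner_add_right, frobInner_neg_right, sub_eq_add_neg]

lemma frobInner_sum_right {ι : Type*} (s : Finset ι) (A : Matrix m n ℝ) (B : ι → Matrix m n ℝ) :
    frobInner A (∑ k ∈ s, B k) = ∑ k ∈ s, frobInner A (B k) := by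
  classical
  induction s using Finset.induction_on with
  | empty => simp [frobInner]
  | insert a s ha ih => rw [Finset.sum_insert ha, Finset.sum_insert ha, frobInner_add_right, ih]

lemma frobInner_add_left (A B C : Matrix m n ℝ) :
    frobInner (A + B) C = frobInner A C + frobInner B C := by
  rw [frobInner_comm, frobInner_add_right, frobInner_comm C, frobInner_comm C]

lemma frobInner_sub_left (A B C : Matrix m n ℝ) :
    frobInner (A - B) C = frobInner A C - frobInner B C := by
  rw [frobInner_comm, frobInner_sub_right, frobInner_comm C, frobInner_comm C]

lemma frobInner_smul_left (a : ℝ) (A B : Matrix m n ℝ) :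
    frobInner (a • A) B = a * frobInner A B := by
  rw [frobInner_comm, frobInner_smul_right, frobInner_comm]

lemma frobInner_sum_left {ι : Type*} (s : Finset ι) (A : Matrix m n ℝ) (B : ι → Matrix m n ℝ) :
    frobInner (∑ k ∈ s, B k) A = ∑ k ∈ s, frobInner (B k) A := by
  simp [frobInner_comm _ A, frobInner_sum_right]

lemma abs_frobInner_le (A B : Matrix m n ℝ) : |frobInner A B| ≤ frobNorm A * frobNorm B := by
  simpa [frobInner_eq_inner, frobNorm_eq_norm] using abs_real_inner_le_norm (vec A) (vec B)

lemma frobNorm_add_le (A B : Matrix m n ℝ) : frobNorm (A + B) ≤ frobNorm A + frobNorm B := by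
  simpa [frobNorm_eq_norm, vec_add] using norm_add_le (vec A) (vec B)

lemma frobNorm_smul (a : ℝ) (A : Matrix m n ℝ) : frobNorm (a • A) = |a| * frobNorm A := by
  simp [frobNorm_eq_norm, vec_smul, norm_smul]

lemma frobNorm_neg (A : Matrix m n ℝ) : frobNorm (-A) = frobNorm A := by
  simpa using frobNorm_smul (-1) A

lemma frobNorm_sub_le (A B : Matrix m n ℝ) : frobNorm (A - B) ≤ frobNorm A + frobNorm B := by
  rw [sub_eq_add_neg, ← frobNorm_neg B]
  exact frobNorm_add_le _ _

lemma frobNorm_zero : frobNorm (0 : Matrix m n ℝ) = 0 := by simp [frobNorm, frobInner]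

lemma frobNorm_sum_le {ι : Type*} (s : Finset ι) (B : ι → Matrix m n ℝ) :
    frobNorm (∑ k ∈ s, B k) ≤ ∑ k ∈ s, frobNorm (B k) :=
  Finset.le_sum_of_subadditive _ frobNorm_zero.le (fun A B => frobNorm_add_le A B) s B

lemma frobNorm_add_sq (A B : Matrix m n ℝ) :
    frobNorm (A + B) ^ 2 = frobNorm A ^ 2 + 2 * frobInner A B + frobNorm B ^ 2 := by
  simp only [← frobInner_self, frobInner_add_left, frobInner_add_right, frobInner_comm B A]
  ring

lemma abs_entry_le_frobNorm (A : Matrix m n ℝ) (i : m) (t : n) : |A i t| ≤ frobNorm A := by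
  rw [frobNorm_eq_norm]
  exact PiLp.norm_apply_le (vec A) (i, t)

end Frobenius

/-! ### Singular values, low rank perturbations and Eckart–Young. -/

section SingularValues

variable {N T : ℕ}

/-- An orthonormal basis of right singular vectors. -/
noncomputable def rightBasis (A : Mat N T) :
    OrthonormalBasis (Fin T) ℝ (EuclideanSpace ℝ (Fin T)) :=
  (Matrix.toEuclideanLin A).isSymmetric_adjoint_comp_self.eigenvectorBasis (by simp)

lemma inner_apply_rightBasis (A : Mat N T) (x : EuclideanSpace ℝ (Fin T)) (j : Fin T) :
    inner ℝ (Matrix.toEuclideanLin A x) (Matrix.toEuclideanLin A (rightBasis A j)) =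
      (Matrix.toEuclideanLin A).singularValues j ^ 2 * inner ℝ x (rightBasis A j) := by
  have hT : Module.finrank ℝ (EuclideanSpace ℝ (Fin T)) = T := by simp
  rw [← LinearMap.adjoint_inner_right, ← LinearMap.comp_apply, rightBasis,
    LinearMap.IsSymmetric.apply_eigenvectorBasis, inner_smul_right,
    LinearMap.sq_singularValues_fin _ hT]
  rfl

lemma norm_apply_sq (A : Mat N T) (x : EuclideanSpace ℝ (Fin T)) :
    ‖Matrix.toEuclideanLin A x‖ ^ 2 =
      ∑ j : Fin T, (Matrix.toEuclideanLin A).singularValues j ^ 2 * inner ℝ x (rightBasis A j) ^ 2 := by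
  rw [← real_inner_self_eq_norm_sq]
  conv_lhs =>
    enter [2]
    rw [← (rightBasis A).sum_repr' x]
  rw [map_sum, sum_inner]
  refine Finset.sum_congr rfl fun j _ => ?_
  rw [map_smul, real_inner_smul_left, real_inner_comm (Matrix.toEuclideanLin A x),
    inner_apply_rightBasis, real_inner_comm x]
  ring

lemma norm_apply_rightBasis (A : Mat N T) (j : Fin T) :
    ‖Matrix.toEuclideanLin A (rightBasis A j)‖ = (Matrix.toEuclideanLin A).singularValues j := by
  have h := inner_apply_rightBasis A (rightBasis A j) j
  rw [real_inner_self_eq_norm_sq, real_inner_self_eq_norm_sq, (rightBasis A).norm_eq_one,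
    one_pow, mul_one] at h
  exact (pow_left_inj₀ (norm_nonneg _) (LinearMap.singularValues_nonneg _ _) two_ne_zero).1 h

lemma rank_eq_finrank_range (A : Mat N T) :
    A.rank = Module.finrank ℝ (Matrix.toEuclideanLin A).range := by
  have h : Matrix.toEuclideanLin A = Matrix.toLin _ _ A :=
    LinearEquiv.congr_fun (Matrix.toLpLin_eq_toLin 2 2) A
  rw [h]
  exact A.rank_eq_finrank_range_toLin _ _

lemma apply_rightBasis_eq_zero {A : Mat N T} {k : ℕ} (hA : A.rank ≤ k) (j : Fin T)
    (hj : k ≤ j) : Matrix.toEuclideanLin A (rightBasis A j) = 0 := by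
  rw [← norm_eq_zero, norm_apply_rightBasis,
    LinearMap.singularValues_eq_zero_iff_le_finrank_range, ← rank_eq_finrank_range]
  exact hA.trans hj

lemma sv_nonneg (A : Mat N T) (r : ℕ) : 0 ≤ sv A r := LinearMap.singularValues_nonneg _ _

lemma norm_apply_le (A : Mat N T) (x : EuclideanSpace ℝ (Fin T)) :
    ‖Matrix.toEuclideanLin A x‖ ≤ sv A 1 * ‖x‖ := by
  refine le_of_sq_le_sq ?_ (mul_nonneg (sv_nonneg _ _) (norm_nonneg _))
  rw [norm_apply_sq, mul_pow, ← (rightBasis A).sum_sq_inner_left x, Finset.mul_sum]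
  refine Finset.sum_le_sum fun j _ => ?_
  gcongr
  · exact LinearMap.singularValues_nonneg _ _
  · exact LinearMap.singularValues_antitone _ (by simp)

/-- Weyl-type argument: the span of the first k + 1 right singular vectors of A meets the kernel of
D, which has codimension at most k, in a nonzero vector x. There (A + D)x = Ax, and ‖Ax‖ ≥
s_{k+1}(A) ‖x‖. The (k+1)-st singular value carries the zero-based index k. -/
lemma sv_le_of_rank_le {A D : Mat N T} {k : ℕ} {c : ℝ} (hD : D.rank ≤ k) (hc : 0 ≤ c)
    (h : ∀ x, ‖Matrix.toEuclideanLin (A + D) x‖ ≤ c * ‖x‖) : sv A (k + 1) ≤ c := by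
  rcases le_or_gt T k with hk | hk
  · rw [sv, Nat.add_sub_cancel, LinearMap.singularValues_of_finrank_le _ (by simpa using hk)]
    exact hc
  let e : Fin (k + 1) → Fin T := Fin.castLE hk
  let f : (Fin (k + 1) → ℝ) →ₗ[ℝ] EuclideanSpace ℝ (Fin T) :=
    Fintype.linearCombination ℝ fun i => rightBasis A (e i)
  have hfr : Module.finrank ℝ (Matrix.toEuclideanLin D).range < 
      Module.finrank ℝ (Fin (k + 1) → ℝ) := by
    rw [← rank_eq_finrank_range]
    simpa using Nat.lt_succ_of_le hD
  obtain ⟨a, ha, ha0⟩ := Submodule.exists_mem_ne_zero_of_ne_bot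
    (LinearMap.ker_ne_bot_of_finrank_lt (f := (Matrix.toEuclideanLin D).rangeRestrict ∘ₗ f) hfr)
  have hD0 : Matrix.toEuclideanLin D (f a) = 0 := by
    simpa [Subtype.ext_iff] using ha
  have hfa : f a = ∑ i, a i • rightBasis A (e i) := by
    simp [f, Fintype.linearCombination_apply]
  have he : Orthonormal ℝ fun i => rightBasis A (e i) :=
    (rightBasis A).orthonormal.comp e (Fin.castLE_injective hk)
  have hx : f a ≠ 0 := by
    intro h0
    rw [hfa] at h0
    exact ha0 (funext (Fintype.linearIndependent_iff.1 he.linearIndependent a h0))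
  have hin : ∀ j : Fin T, k < j → inner ℝ (f a) (rightBasis A j) = 0 := by
    intro j hj
    rw [hfa, sum_inner]
    refine Finset.sum_eq_zero fun i _ => ?_
    rw [inner_smul_left, (rightBasis A).inner_eq_zero, mul_zero]
    intro hij
    have : (i : ℕ) = j := congrArg Fin.val hij
    omega
  have key : (sv A (k + 1) * ‖f a‖) ^ 2 ≤ ‖Matrix.toEuclideanLin (A + D) (f a)‖ ^ 2 := by
    rw [map_add, LinearMap.add_apply, hD0, add_zero, norm_apply_sq, mul_pow,
      ← (rightBasis A).sum_sq_inner_left (f a), Finset.mul_sum]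
    refine Finset.sum_le_sum fun j _ => ?_
    rcases lt_or_ge k (j : ℕ) with hj | hj
    · rw [hin j hj]
      simp
    · gcongr
      · exact sv_nonneg _ _
      · exact LinearMap.singularValues_antitone _ hj
  have := (le_of_sq_le_sq key (norm_nonneg _)).trans (h (f a))
  exact le_of_mul_le_mul_right this (norm_pos_iff.2 hx)

lemma sv_one_le {A : Mat N T} {c : ℝ} (hc : 0 ≤ c)
    (h : ∀ x, ‖Matrix.toEuclideanLin A x‖ ≤ c * ‖x‖) : sv A 1 ≤ c :=
  sv_le_of_rank_le (A := A) (D := 0) (k := 0) (by simp) hc (by simpa using h)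

lemma sv_le_sv_one_add {A D : Mat N T} {k : ℕ} (hD : D.rank ≤ k) :
    sv A (k + 1) ≤ sv (A + D) 1 :=
  sv_le_of_rank_le hD (sv_nonneg _ _) (norm_apply_le _)

lemma sv_one_add_le (A B : Mat N T) : sv (A + B) 1 ≤ sv A 1 + sv B 1 := by
  refine sv_one_le (add_nonneg (sv_nonneg _ _) (sv_nonneg _ _)) fun x => ?_
  rw [map_add, LinearMap.add_apply, add_mul]
  exact (norm_add_le _ _).trans (add_le_add (norm_apply_le A x) (norm_apply_le B x))

lemma sv_one_smul_le (a : ℝ) (A : Mat N T) : sv (a • A) 1 ≤ |a| * sv A 1 := by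
  refine sv_one_le (mul_nonneg (abs_nonneg _) (sv_nonneg _ _)) fun x => ?_
  rw [map_smul, LinearMap.smul_apply, norm_smul, mul_assoc]
  exact mul_le_mul_of_nonneg_left (norm_apply_le A x) (norm_nonneg _)

lemma sv_one_neg_le (A : Mat N T) : sv (-A) 1 ≤ sv A 1 := by
  simpa using sv_one_smul_le (-1) A

lemma frobInner_eq_sum_inner {ι : Type*} [Fintype ι] (A B : Mat N T)
    (b : OrthonormalBasis ι ℝ (EuclideanSpace ℝ (Fin T))) :
    frobInner A B =
      ∑ j, inner ℝ (Matrix.toEuclideanLin A (b j)) (Matrix.toEuclideanLin B (b j)) := by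
  have hrow : ∀ (A : Mat N T) (x : EuclideanSpace ℝ (Fin T)) (i : Fin N),
      Matrix.toEuclideanLin A x i = inner ℝ (WithLp.toLp 2 (A i)) x := by
    intro A x i
    simp [Matrix.toLpLin_apply, Matrix.mulVec, dotProduct, PiLp.inner_apply, mul_comm]
  have h1 : ∀ i, ∑ t, A i t * B i t =
      inner ℝ (WithLp.toLp 2 (A i) : EuclideanSpace ℝ (Fin T)) (WithLp.toLp 2 (B i)) := by
    intro i
    simp [PiLp.inner_apply, mul_comm]
  simp only [frobInner, h1]
  rw [Finset.sum_congr rfl fun i _ => (b.sum_inner_mul_inner _ _).symm]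
  rw [Finset.sum_comm]
  refine Finset.sum_congr rfl fun j _ => ?_
  rw [PiLp.inner_apply]
  refine Finset.sum_congr rfl fun i _ => ?_
  rw [hrow, hrow, real_inner_comm (b j) (WithLp.toLp 2 (B i))]
  exact mul_comm _ _

lemma frobNorm_sq_eq_sum {ι : Type*} [Fintype ι] (A : Mat N T)
    (b : OrthonormalBasis ι ℝ (EuclideanSpace ℝ (Fin T))) :
    frobNorm A ^ 2 = ∑ j, ‖Matrix.toEuclideanLin A (b j)‖ ^ 2 := by
  rw [← frobInner_self, frobInner_eq_sum_inner A A b]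
  simp

lemma sv_one_le_frobNorm (A : Mat N T) : sv A 1 ≤ frobNorm A := by
  rcases Nat.eq_zero_or_pos T with rfl | hT
  · rw [sv, LinearMap.singularValues_of_finrank_le _ (by simp)]
    exact frobNorm_nonneg _
  · refine le_of_sq_le_sq ?_ (frobNorm_nonneg _)
    rw [frobNorm_sq_eq_sum A (rightBasis A)]
    have := Finset.single_le_sum (f := fun j => ‖Matrix.toEuclideanLin A (rightBasis A j)‖ ^ 2)
      (fun j _ => sq_nonneg _) (Finset.mem_univ (⟨0, hT⟩ : Fin T))
    simpa [norm_apply_rightBasis, sv] using this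

lemma card_filter_val_lt_le (T k : ℕ) :
    (Finset.univ.filter fun j : Fin T => (j : ℕ) < k).card ≤ k := by
  calc _ = ((Finset.univ.filter fun j : Fin T => (j : ℕ) < k).map Fin.valEmbedding).card := by
        rw [Finset.card_map]
    _ ≤ (Finset.range k).card := Finset.card_le_card (by intro x; simp; omega)
    _ = k := by simp

/-- Duality between the spectral and the nuclear norm for matrices of bounded rank. -/
lemma abs_frobInner_le_of_rank_le (A : Mat N T) {D : Mat N T} {k : ℕ} (hD : D.rank ≤ k) :
    |frobInner A D| ≤ sv A 1 * (√k * frobNorm D) := by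
  -- In the right singular basis of D only the first k terms of the trace survive; Cauchy–Schwarz
  -- over these terms produces √k.
  set b := rightBasis D
  set s := Finset.univ.filter fun j : Fin T => (j : ℕ) < k
  have h0 : ∀ j, j ∉ s → Matrix.toEuclideanLin D (b j) = 0 := fun j hj =>
    apply_rightBasis_eq_zero hD j (by simpa [s] using hj)
  have h1 : frobInner A D =
      ∑ j ∈ s, inner ℝ (Matrix.toEuclideanLin A (b j)) (Matrix.toEuclideanLin D (b j)) := by
    rw [frobInner_eq_sum_inner A D b]
    refine (Finset.sum_subset (Finset.subset_univ s) fun j _ hj => ?_).symm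
    rw [h0 j hj, inner_zero_right]
  have h2 : ∑ j ∈ s, ‖Matrix.toEuclideanLin D (b j)‖ ≤ √k * frobNorm D := by
    refine (Real.le_sqrt_of_sq_le (y := k * frobNorm D ^ 2) ?_).trans (le_of_eq ?_)
    · refine (sq_sum_le_card_mul_sum_sq).trans ?_
      rw [frobNorm_sq_eq_sum D b]
      exact mul_le_mul (by exact_mod_cast card_filter_val_lt_le T k)
        (Finset.sum_le_sum_of_subset_of_nonneg (Finset.subset_univ s) fun _ _ _ => sq_nonneg _)
        (Finset.sum_nonneg fun _ _ => sq_nonneg _) (Nat.cast_nonneg k)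
    · rw [Real.sqrt_mul (by positivity), Real.sqrt_sq (frobNorm_nonneg _)]
  calc |frobInner A D| ≤ ∑ j ∈ s, sv A 1 * ‖Matrix.toEuclideanLin D (b j)‖ := by
        rw [h1]
        refine (Finset.abs_sum_le_sum_abs _ _).trans (Finset.sum_le_sum fun j _ => ?_)
        refine (abs_real_inner_le_norm _ _).trans ?_
        gcongr
        simpa using norm_apply_le A (b j)
    _ ≤ _ := by
        rw [← Finset.mul_sum]
        exact mul_le_mul_of_nonneg_left h2 (sv_nonneg _ _)

/-- The Eckart–Young lower bound for approximation by matrices of rank at most `k`. -/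
lemma sum_sv_sq_le_of_rank_le (B : Mat N T) {D : Mat N T} {k : ℕ} (hD : D.rank ≤ k) :
    ∑ r ∈ Finset.Icc (k + 1) (min N T), sv B r ^ 2 ≤ frobNorm (B + D) ^ 2 := by
  set w := rightBasis D
  set v := rightBasis B
  set σ : Fin T → ℝ := fun i => (Matrix.toEuclideanLin B).singularValues i ^ 2
  have hσ : ∀ i, 0 ≤ σ i := fun i => sq_nonneg _
  set s := Finset.univ.filter fun j : Fin T => (j : ℕ) < k
  -- Squared length of the projection of v i onto the span of the leading right singular vectors of
  -- D. These weights lie in [0, 1] and sum to the cardinality of s.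
  set p : Fin T → ℝ := fun i => ∑ j ∈ s, inner ℝ (w j) (v i) ^ 2
  have hp0 : ∀ i, 0 ≤ p i := fun i => Finset.sum_nonneg fun _ _ => sq_nonneg _
  have hpall : ∀ i, ∑ j, inner ℝ (w j) (v i) ^ 2 = 1 := by
    intro i
    rw [w.sum_sq_inner_right, v.norm_eq_one, one_pow]
  have hp1 : ∀ i, p i ≤ 1 := fun i => by
    rw [← hpall i]
    exact Finset.sum_le_sum_of_subset_of_nonneg (Finset.subset_univ s) fun _ _ _ => sq_nonneg _
  have hps : ∑ i, p i = s.card := by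
    rw [Finset.sum_comm, Finset.sum_congr rfl fun j _ => ?_, Finset.sum_const, nsmul_one]
    rw [v.sum_sq_inner_left, w.norm_eq_one, one_pow]
  have hsub : ∑ r ∈ Finset.Icc (k + 1) (min N T), sv B r ^ 2 ≤ ∑ i ∈ sᶜ, σ i := by
    let e : Fin T ↪ ℕ := ⟨fun i => i + 1, fun i j h => by simpa [Fin.ext_iff] using h⟩
    have : ∑ i ∈ sᶜ, σ i = ∑ r ∈ sᶜ.map e, sv B r ^ 2 := by
      rw [Finset.sum_map]
      rfl
    rw [this]
    refine Finset.sum_le_sum_of_subset_of_nonneg (fun r hr => ?_) fun _ _ _ => sq_nonneg _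
    simp only [Finset.mem_Icc, le_min_iff] at hr
    exact Finset.mem_map.2 ⟨⟨r - 1, by omega⟩, by simp [s]; omega,
      Nat.sub_add_cancel (by omega)⟩
  set τ : ℝ := (Matrix.toEuclideanLin B).singularValues k ^ 2
  have hmain : ∑ i ∈ sᶜ, σ i ≤ ∑ i, σ i * (1 - p i) := by
    -- Bathtub principle with threshold τ: moving the mass of p onto the largest σ i can only
    -- decrease the remaining sum. The τ-terms cancel on summation, since p and the indicator of s
    -- have equal total mass.
    have hpt : ∀ i, τ * ((if i ∈ s then 1 else 0) - p i) + (if i ∈ sᶜ then σ i else 0) ≤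
        σ i * (1 - p i) := by
      intro i
      by_cases hi : i ∈ s
      · have hik : (i : ℕ) < k := by simpa [s] using hi
        have : τ ≤ σ i := pow_le_pow_left₀ (LinearMap.singularValues_nonneg _ _)
          (LinearMap.singularValues_antitone _ hik.le) 2
        simp only [hi, if_true, Finset.mem_compl, not_true, if_false, add_zero]
        exact mul_le_mul_of_nonneg_right this (by linarith [hp1 i])
      · have hik : k ≤ (i : ℕ) := by simpa [s] using hi
        have : σ i ≤ τ := pow_le_pow_left₀ (LinearMap.singularValues_nonneg _ _)
          (LinearMap.singularValues_antitone _ hik) 2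
        simp only [hi, if_false, Finset.mem_compl, not_false_eq_true, if_true]
        nlinarith [hp0 i]
    have := Finset.sum_le_sum fun i (_ : i ∈ Finset.univ) => hpt i
    rw [Finset.sum_add_distrib, ← Finset.mul_sum, Finset.sum_sub_distrib, hps] at this
    simp only [Finset.sum_ite_mem, Finset.univ_inter] at this
    simpa using this
  -- The weighted sum is the energy of B on the directions w j with j outside s, where D vanishes
  -- and B may be replaced by B + D.
  have hB : ∑ i, σ i * (1 - p i) = ∑ j ∈ sᶜ, ‖Matrix.toEuclideanLin B (w j)‖ ^ 2 := by
    have h1p : ∀ i, 1 - p i = ∑ j ∈ sᶜ, inner ℝ (w j) (v i) ^ 2 := fun i => by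
      rw [← hpall i, ← Finset.sum_add_sum_compl s, add_sub_cancel_left]
    simp only [h1p, norm_apply_sq B, Finset.mul_sum]
    exact Finset.sum_comm
  calc _ ≤ ∑ j ∈ sᶜ, ‖Matrix.toEuclideanLin B (w j)‖ ^ 2 := by
        rw [← hB]
        exact hsub.trans hmain
    _ = ∑ j ∈ sᶜ, ‖Matrix.toEuclideanLin (B + D) (w j)‖ ^ 2 := by
        refine Finset.sum_congr rfl fun j hj => ?_
        rw [map_add, LinearMap.add_apply,
          apply_rightBasis_eq_zero hD j (by simpa [s] using hj), add_zero]
    _ ≤ _ := by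
        rw [frobNorm_sq_eq_sum (B + D) w]
        exact Finset.sum_le_sum_of_subset_of_nonneg (Finset.subset_univ _) fun _ _ _ => sq_nonneg _

end SingularValues

/-! ### Least squares with a low rank component: existence and error bounds. -/

section LeastSquares

variable {N T K R : ℕ}

/-- The Euclidean norm of a coefficient vector `(b, d)`. -/
noncomputable def parNorm (g : ℝ × (Fin K → ℝ)) : ℝ := √(g.1 ^ 2 + ∑ k, g.2 k ^ 2)

lemma parNorm_nonneg (g : ℝ × (Fin K → ℝ)) : 0 ≤ parNorm g := Real.sqrt_nonneg _

lemma parNorm_sq (g : ℝ × (Fin K → ℝ)) : parNorm g ^ 2 = g.1 ^ 2 + ∑ k, g.2 k ^ 2 :=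
  Real.sq_sqrt (add_nonneg (sq_nonneg _) (Finset.sum_nonneg fun _ _ => sq_nonneg _))

lemma abs_fst_le_parNorm (g : ℝ × (Fin K → ℝ)) : |g.1| ≤ parNorm g := by
  refine abs_le_of_sq_le_sq ?_ (parNorm_nonneg g)
  rw [parNorm_sq]
  exact le_add_of_nonneg_right (Finset.sum_nonneg fun _ _ => sq_nonneg _)

lemma abs_snd_le_parNorm (g : ℝ × (Fin K → ℝ)) (k : Fin K) : |g.2 k| ≤ parNorm g := by
  refine abs_le_of_sq_le_sq ?_ (parNorm_nonneg g)
  rw [parNorm_sq]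
  have := Finset.single_le_sum (f := fun k => g.2 k ^ 2) (fun _ _ => sq_nonneg _)
    (Finset.mem_univ k)
  linarith [sq_nonneg g.1]

lemma norm_le_parNorm (g : ℝ × (Fin K → ℝ)) : ‖g‖ ≤ parNorm g :=
  max_le (abs_fst_le_parNorm g)
    ((pi_norm_le_iff_of_nonneg (parNorm_nonneg g)).2 (abs_snd_le_parNorm g))

lemma lin_sub (X : Mat N T) (Z : Fin K → Mat N T) (g g' : ℝ × (Fin K → ℝ)) :
    lin X Z (g - g') = lin X Z g - lin X Z g' := by
  simp only [lin, Prod.fst_sub, Prod.snd_sub, Pi.sub_apply, sub_smul, Finset.sum_sub_distrib]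
  abel

lemma lin_smul (X : Mat N T) (Z : Fin K → Mat N T) (a : ℝ) (g : ℝ × (Fin K → ℝ)) :
    lin X Z (a • g) = a • lin X Z g := by
  simp [lin, smul_add, Finset.smul_sum, mul_smul]

lemma frobNorm_lin_le {X : Mat N T} {Z : Fin K → Mat N T} {B r : ℝ} {g : ℝ × (Fin K → ℝ)}
    (hX : frobNorm X ≤ B) (hZ : ∀ k, frobNorm (Z k) ≤ B) (h1 : |g.1| ≤ r)
    (h2 : ∀ k, |g.2 k| ≤ r) : frobNorm (lin X Z g) ≤ (K + 1) * (r * B) := by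
  have hr : 0 ≤ r := (abs_nonneg _).trans h1
  calc frobNorm (lin X Z g) ≤ |g.1| * frobNorm X + ∑ k, |g.2 k| * frobNorm (Z k) := by
        refine (frobNorm_add_le _ _).trans (add_le_add (frobNorm_smul _ _).le ?_)
        exact (frobNorm_sum_le _ _).trans (Finset.sum_le_sum fun k _ => (frobNorm_smul _ _).le)
    _ ≤ r * B + ∑ _k : Fin K, r * B := by
        gcongr with k
        · exact frobNorm_nonneg _
        · exact frobNorm_nonneg _
        · exact h2 k
        · exact hZ k
    _ = _ := by simp; ring

lemma abs_frobInner_lin_le {X : Mat N T} {Z : Fin K → Mat N T} {U : Mat N T} {B : ℝ}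
    (g : ℝ × (Fin K → ℝ)) (hX : |frobInner X U| ≤ B) (hZ : ∀ k, |frobInner (Z k) U| ≤ B) :
    |frobInner (lin X Z g) U| ≤ (K + 1) * (parNorm g * B) := by
  have hr := parNorm_nonneg g
  calc |frobInner (lin X Z g) U|
      ≤ |g.1| * |frobInner X U| + ∑ k, |g.2 k| * |frobInner (Z k) U| := by
        rw [lin, frobInner_add_left, frobInner_smul_left, frobInner_sum_left, ← abs_mul]
        refine (abs_add_le _ _).trans (add_le_add le_rfl ?_)
        refine (Finset.abs_sum_le_sum_abs _ _).trans (Finset.sum_le_sum fun k _ => ?_)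
        rw [frobInner_smul_left, abs_mul]
    _ ≤ parNorm g * B + ∑ _k : Fin K, parNorm g * B := by
        gcongr with k
        · exact abs_fst_le_parNorm g
        · exact abs_snd_le_parNorm g k
        · exact hZ k
    _ = _ := by simp; ring

lemma rank_smul_le (a : ℝ) (A : Mat N T) : (a • A).rank ≤ A.rank := by
  simpa using Matrix.rank_mul_le_left A (a • (1 : Matrix (Fin T) (Fin T) ℝ))

lemma rank_add_le (A B : Mat N T) : (A + B).rank ≤ A.rank + B.rank := by
  unfold Matrix.rank
  rw [Matrix.mulVecLin_add]
  exact (Submodule.finrank_mono (LinearMap.range_add_le _ _)).trans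
    (Submodule.finrank_add_le_finrank_add_finrank _ _)

/-- Generalized non-collinearity of the regressors with constant `s`. -/
def NonCollinear (R : ℕ) (s : ℝ) (X : Mat N T) (Z : Fin K → Mat N T) : Prop :=
  ∀ g : ℝ × (Fin K → ℝ), g.1 ^ 2 + ∑ k, g.2 k ^ 2 = 1 →
    s ≤ 1 / ((N : ℝ) * T) * ∑ r ∈ Finset.Icc (2 * R + 1) (min N T), sv (lin X Z g) r ^ 2

/-- After rescaling g to unit length this is Eckart–Young: a matrix of rank at most 2R cannot cancel
the singular values of `lin X Z g` beyond the 2R-th. The rank 2R is that of a difference of two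
rank-R components. -/
lemma NonCollinear.parNorm_le {s : ℝ} {X : Mat N T} {Z : Fin K → Mat N T}
    (h : NonCollinear R s X Z) (hN : 0 < N) (hT : 0 < T) {D : Mat N T} (hD : D.rank ≤ 2 * R)
    (g : ℝ × (Fin K → ℝ)) :
    √s * (√((N : ℝ) * T) * parNorm g) ≤ frobNorm (lin X Z g + D) := by
  rcases (parNorm_nonneg g).eq_or_lt with h0 | h0
  · rw [← h0, mul_zero, mul_zero]
    exact frobNorm_nonneg _
  have hNT : (0 : ℝ) < N * T := by positivity
  set t := (parNorm g)⁻¹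
  have ht : 0 < t := inv_pos.2 h0
  have hg : (t • g).1 ^ 2 + ∑ k, (t • g).2 k ^ 2 = 1 := by
    simp only [Prod.smul_fst, Prod.smul_snd, Pi.smul_apply, smul_eq_mul, mul_pow,
      ← Finset.mul_sum, ← mul_add, ← parNorm_sq]
    rw [← mul_pow, inv_mul_cancel₀ h0.ne', one_pow]
  have hrank : (t • D).rank ≤ 2 * R :=
    (rank_smul_le t D).trans hD
  have h1 := h _ hg
  have h2 := sum_sv_sq_le_of_rank_le (lin X Z (t • g)) hrank
  rw [lin_smul, ← smul_add, frobNorm_smul, abs_of_pos ht, ← lin_smul] at h2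
  have h3 : s * (N * T) ≤ (t * frobNorm (lin X Z g + D)) ^ 2 := by
    refine le_trans ?_ h2
    rw [one_div, inv_mul_eq_div, le_div_iff₀ hNT] at h1
    exact h1
  have h4 : √s * √((N : ℝ) * T) ≤ t * frobNorm (lin X Z g + D) := by
    rw [← Real.sqrt_mul' _ hNT.le]
    exact Real.sqrt_le_iff.2 ⟨mul_nonneg ht.le (frobNorm_nonneg _), h3⟩
  calc √s * (√((N : ℝ) * T) * parNorm g) = √s * √((N : ℝ) * T) * parNorm g := by ring
    _ ≤ t * frobNorm (lin X Z g + D) * parNorm g := by gcongr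
    _ = _ := by
      simp only [t]
      field_simp

lemma rank_sub_le {G G' : Mat N T} (h : G.rank ≤ R) (h' : G'.rank ≤ R) :
    (G - G').rank ≤ 2 * R := by
  rw [sub_eq_add_neg, ← neg_one_smul ℝ G']
  have h1 := rank_add_le G ((-1 : ℝ) • G')
  have h2 := rank_smul_le (-1) G'
  omega

lemma IsLowRankFit.frobNorm_le {E G G' : Mat N T} (h : IsLowRankFit R E G) (h' : G'.rank ≤ R) :
    frobNorm (E - G) ≤ frobNorm (E - G') := by
  have := h.2 G' h'
  rw [sum_sq_eq_frobNorm_sq, sum_sq_eq_frobNorm_sq] at this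
  exact le_of_sq_le_sq this (frobNorm_nonneg _)

lemma IsLeastSquares.frobNorm_le {Y X : Mat N T} {Z : Fin K → Mat N T}
    {p : (ℝ × (Fin K → ℝ)) × Mat N T} (h : IsLeastSquares R Y X Z p)
    (g : ℝ × (Fin K → ℝ)) {G : Mat N T} (hG : G.rank ≤ R) :
    frobNorm (Y - lin X Z p.1 - p.2) ≤ frobNorm (Y - lin X Z g - G) := by
  have := h.2 (g, G) hG
  rw [sum_sq_eq_frobNorm_sq, sum_sq_eq_frobNorm_sq] at this
  exact le_of_sq_le_sq this (frobNorm_nonneg _)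

/-- Under non-collinearity, the least squares problem attains its minimum. -/
lemma NonCollinear.exists_isLeastSquares {s : ℝ} (hs : 0 < s) {X : Mat N T}
    {Z : Fin K → Mat N T} (h : NonCollinear R s X Z) (hN : 0 < N) (hT : 0 < T)
    (L : Mat N T → Mat N T) (hL : ∀ E, IsLowRankFit R E (L E)) (Y : Mat N T) :
    ∃ p, IsLeastSquares R Y X Z p := by
  -- The low rank part is profiled out, which leaves a finite-dimensional problem in g; f is
  -- continuous by `hlip` and coercive by `hcoer`, so it attains its minimum on a large ball.
  set f : ℝ × (Fin K → ℝ) → ℝ := fun g => frobNorm (Y - lin X Z g - L (Y - lin X Z g))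
  have hf0 : ∀ g, 0 ≤ f g := fun g => frobNorm_nonneg _
  have hcont_aux : ∀ g', Continuous fun g => frobNorm (lin X Z (g - g')) := by
    intro g'
    unfold frobNorm frobInner lin
    fun_prop
  have hlip : ∀ g g', f g ≤ f g' + frobNorm (lin X Z (g - g')) := by
    intro g g'
    calc f g ≤ frobNorm (Y - lin X Z g - L (Y - lin X Z g')) :=
          (hL _).frobNorm_le (hL _).1
      _ = frobNorm ((Y - lin X Z g' - L (Y - lin X Z g')) - lin X Z (g - g')) := by
          congr 1
          rw [lin_sub]
          abel
      _ ≤ _ := frobNorm_sub_le _ _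
  have hlip' : ∀ g g', f g' - frobNorm (lin X Z (g - g')) ≤ f g := by
    intro g g'
    have := hlip g' g
    rw [← neg_sub g g', ← neg_one_smul ℝ (g - g'), lin_smul, neg_one_smul, frobNorm_neg] at this
    linarith
  have hcont : Continuous f := by
    refine continuous_iff_continuousAt.2 fun g' => ?_
    have h0 : Tendsto (fun g => frobNorm (lin X Z (g - g'))) (𝓝 g') (𝓝 0) := by
      have h1 := (hcont_aux g').tendsto g'
      have h2 : frobNorm (lin X Z (g' - g')) = 0 := by
        rw [lin_sub, sub_self, frobNorm_zero]
      rwa [h2] at h1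
    refine tendsto_of_tendsto_of_tendsto_of_le_of_le (by simpa using tendsto_const_nhds.sub h0)
      (by simpa using tendsto_const_nhds.add h0) (fun g => hlip' g g') (fun g => hlip g g')
  set c := √s * √((N : ℝ) * T)
  have hc : 0 < c := by positivity
  have hcoer : ∀ g, c * parNorm g ≤ f g + frobNorm Y := by
    intro g
    have h1 := h.parNorm_le hN hT (D := L (Y - lin X Z g)) ((hL _).1.trans (by omega)) g
    have h2 : lin X Z g + L (Y - lin X Z g) = Y - (Y - lin X Z g - L (Y - lin X Z g)) := by abel
    rw [h2, ← mul_assoc] at h1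
    exact (h1.trans (frobNorm_sub_le _ _)).trans (le_of_eq (add_comm _ _))
  set ρ := (f 0 + frobNorm Y) / c
  have hρ : 0 ≤ ρ := div_nonneg (add_nonneg (hf0 0) (frobNorm_nonneg _)) hc.le
  obtain ⟨g₀, -, hg₀⟩ := (isCompact_closedBall (0 : ℝ × (Fin K → ℝ)) ρ).exists_isMinOn
    ⟨0, by simpa using hρ⟩ hcont.continuousOn
  have hmin : ∀ g, f g₀ ≤ f g := by
    intro g
    by_cases hg : g ∈ Metric.closedBall (0 : ℝ × (Fin K → ℝ)) ρ
    · exact hg₀ hg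
    · have h1 : ρ < parNorm g := by
        rw [mem_closedBall_zero_iff, not_le] at hg
        exact hg.trans_le (norm_le_parNorm g)
      have h2 : f g₀ ≤ f 0 := hg₀ (Metric.mem_closedBall_self hρ)
      have h3 := hcoer g
      rw [div_lt_iff₀ hc] at h1
      linarith
  refine ⟨(g₀, L (Y - lin X Z g₀)), (hL _).1, fun q hq => ?_⟩
  rw [sum_sq_eq_frobNorm_sq, sum_sq_eq_frobNorm_sq]
  exact pow_le_pow_left₀ (frobNorm_nonneg _) ((hmin q.1).trans ((hL _).frobNorm_le hq)) 2

/-- A low rank fit to a low rank matrix plus noise `F` errs by at most a multiple of the spectral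
norm of the noise. -/
lemma IsLowRankFit.frobNorm_error_le {G F Gh : Mat N T} (h : IsLowRankFit R (G + F) Gh)
    (hG : G.rank ≤ R) : frobNorm (G - Gh) ≤ 2 * √(2 * R) * sv F 1 := by
  have h1 := h.frobNorm_le hG
  have h2 : G + F - Gh = F + (G - Gh) := by abel
  -- The true G competes with Gh, so ‖F + D‖ ≤ ‖F‖ with D = G - Gh. Expanding gives ‖D‖² ≤ 2|⟨F,
  -- D⟩|, and duality allows division by ‖D‖.
  rw [add_sub_cancel_left, h2] at h1
  have h3 := pow_le_pow_left₀ (frobNorm_nonneg _) h1 2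
  rw [frobNorm_add_sq] at h3
  have h4 := (abs_le.1 (abs_frobInner_le_of_rank_le F (rank_sub_le hG h.1))).1
  push_cast at h4
  rcases (frobNorm_nonneg (G - Gh)).eq_or_lt with h0 | h0
  · rw [← h0]
    have := sv_nonneg F 1
    positivity
  · refine le_of_mul_le_mul_right ?_ h0
    nlinarith

/-- The error of the least squares estimate of the low rank component. -/
lemma IsLeastSquares.frobNorm_error_le {s C m : ℝ} (hs : 0 < s) (hm : 1 ≤ m) {X : Mat N T}
    {Z : Fin K → Mat N T} (h : NonCollinear R s X Z) (hN : 0 < N) (hT : 0 < T)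
    {G U : Mat N T} {θ : ℝ × (Fin K → ℝ)} {p : (ℝ × (Fin K → ℝ)) × Mat N T}
    (hp : IsLeastSquares R (lin X Z θ + G + U) X Z p) (hG : G.rank ≤ R)
    (hC : 0 ≤ C)
    (hX : frobNorm X ≤ C * √((N : ℝ) * T)) (hZ : ∀ k, frobNorm (Z k) ≤ C * √((N : ℝ) * T))
    (hXU : |frobInner X U| ≤ C * √((N : ℝ) * T))
    (hZU : ∀ k, |frobInner (Z k) U| ≤ C * √((N : ℝ) * T)) (hU : sv U 1 ≤ C * m) :
    frobNorm (G - p.2) ≤ (1 + (K + 1) * C / √s) *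
      (2 * ((K + 1) * C / √s) + 2 * √(2 * R) * C * (1 + (K + 1) * C / √s)) * m := by
  set D := G - p.2
  set Δ := θ - p.1
  set W := lin X Z Δ
  set q := frobNorm (W + D)
  set n := √((N : ℝ) * T)
  have hn : 0 < n := by positivity
  have hss : 0 < √s := Real.sqrt_pos.2 hs
  set κ := (K + 1) * C / √s
  have hκ : 0 ≤ κ := by positivity
  have hq0 : 0 ≤ q := frobNorm_nonneg _
  have hD : D.rank ≤ 2 * R := rank_sub_le hG hp.1
  have h1 := hp.frobNorm_le θ hG
  have e1 : lin X Z θ + G + U - lin X Z p.1 - p.2 = U + (W + D) := by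
    simp only [W, Δ, D, lin_sub]
    abel
  have e2 : lin X Z θ + G + U - lin X Z θ - G = U := by abel
  rw [e1, e2] at h1
  have h2 := pow_le_pow_left₀ (frobNorm_nonneg _) h1 2
  -- Basic inequality q² ≤ -2⟨W, U⟩ - 2⟨U, D⟩. Exogeneity controls the first product, duality the
  -- second, and non-collinearity turns both into multiples of q, so one factor q cancels.
  rw [frobNorm_add_sq, frobInner_add_right, frobInner_comm U W] at h2
  have h3 := (abs_le.1 (abs_frobInner_le_of_rank_le U hD)).1
  push_cast at h3
  have h4 := (abs_le.1 (abs_frobInner_lin_le Δ hXU hZU)).1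
  have h5 := h.parNorm_le hN hT hD Δ
  have hΔ : n * parNorm Δ ≤ q / √s := by
    rw [le_div_iff₀ hss]
    linarith
  have h6 : (K + 1) * (parNorm Δ * (C * n)) ≤ κ * q := by
    calc (K + 1) * (parNorm Δ * (C * n)) = (K + 1) * C * (n * parNorm Δ) := by ring
      _ ≤ (K + 1) * C * (q / √s) := by gcongr
      _ = κ * q := by simp only [κ]; ring
  have hW : frobNorm W ≤ κ * q :=
    (frobNorm_lin_le hX hZ (abs_fst_le_parNorm Δ) (abs_snd_le_parNorm Δ)).trans h6
  have hDq : frobNorm D ≤ (1 + κ) * q := by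
    have : D = (W + D) - W := by abel
    rw [this]
    refine (frobNorm_sub_le _ _).trans ?_
    linarith
  have h7 : sv U 1 * (√(2 * R) * frobNorm D) ≤ (C * m) * (√(2 * R) * ((1 + κ) * q)) := by
    gcongr
    exact mul_nonneg (Real.sqrt_nonneg _) (frobNorm_nonneg _)
  have hqm : q ≤ (2 * κ + 2 * √(2 * R) * C * (1 + κ)) * m := by
    rcases hq0.eq_or_lt with h0 | h0
    · rw [← h0]
      positivity
    · refine le_of_mul_le_mul_right ?_ h0
      -- The regressor term is bounded without the factor m; 1 ≤ m lets it be merged with the noise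
      -- term.
      have : κ * q ≤ κ * q * m := le_mul_of_one_le_right (by positivity) hm
      nlinarith
  calc frobNorm D ≤ (1 + κ) * q := hDq
    _ ≤ (1 + κ) * ((2 * κ + 2 * √(2 * R) * C * (1 + κ)) * m) := by gcongr
    _ = _ := by ring

end LeastSquares

/-! ### A feasible weight of the optimal order, and the size of the optimal weight. -/

section Weights

variable {N T K R : ℕ}

/-- The square root of the number of entries. -/
noncomputable def rootDim (N T : ℕ) : ℝ := √((N : ℝ) * T)

/-- The rate `max {√N, √T}`. -/
noncomputable def maxDim (N T : ℕ) : ℝ := max √(N : ℝ) √(T : ℝ)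

/-- The rate `min {√N, √T}`. -/
noncomputable def minDim (N T : ℕ) : ℝ := min √(N : ℝ) √(T : ℝ)

lemma minDim_mul_maxDim (N T : ℕ) : minDim N T * maxDim N T = rootDim N T := by
  rw [minDim, maxDim, min_mul_max, rootDim, Real.sqrt_mul (Nat.cast_nonneg N)]

lemma minDim_le_maxDim (N T : ℕ) : minDim N T ≤ maxDim N T := min_le_max

lemma one_le_minDim (hN : 0 < N) (hT : 0 < T) : 1 ≤ minDim N T :=
  le_min (Real.one_le_sqrt.2 (by exact_mod_cast hN)) (Real.one_le_sqrt.2 (by exact_mod_cast hT))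

lemma minDim_sq (N T : ℕ) : minDim N T ^ 2 = (min N T : ℕ) := by
  rcases le_total N T with h | h
  · rw [minDim, min_eq_left (Real.sqrt_le_sqrt (by exact_mod_cast h)), min_eq_left h,
      Real.sq_sqrt (Nat.cast_nonneg _)]
  · rw [minDim, min_eq_right (Real.sqrt_le_sqrt (by exact_mod_cast h)), min_eq_right h,
      Real.sq_sqrt (Nat.cast_nonneg _)]

lemma sq_le_maxSq (A : Mat N T) (i : Fin N) (t : Fin T) : A i t ^ 2 ≤ maxSq A :=
  (le_ciSup (f := fun t => A i t ^ 2) (Set.finite_range _).bddAbove t).trans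
    (le_ciSup (f := fun i => ⨆ t, A i t ^ 2) (Set.finite_range _).bddAbove i)

lemma maxSq_nonneg (A : Mat N T) : 0 ≤ maxSq A :=
  Real.iSup_nonneg fun _ => Real.iSup_nonneg fun _ => sq_nonneg _

lemma lind_le {A : Mat N T} {c : ℝ} (hc : 0 ≤ c) (h : ∀ i t, A i t ^ 2 ≤ c * frobNorm A ^ 2) :
    lind A ≤ c := by
  rw [lind, sum_sq_eq_frobNorm_sq]
  have h0 : 0 ≤ c * frobNorm A ^ 2 := mul_nonneg hc (sq_nonneg _)
  exact div_le_of_le_mul₀ (sq_nonneg _) hc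
    (Real.iSup_le (fun i => Real.iSup_le (fun t => h i t) h0) h0)

/-- Quantitative form, for given data, of a decomposition `X = Z · π + H + V`. -/
structure DecompBound (C η : ℝ) (c : ℝ≥0∞) (X : Mat N T) (Z : Fin K → Mat N T)
    (π : Fin K → ℝ) (H V : Mat N T) : Prop where
  decomp : X = ∑ k, π k • Z k + H + V
  norm_V : frobNorm V ≤ C * rootDim N T
  le_norm_V : rootDim N T ≤ C * frobNorm V
  sn_V : sv V 1 ≤ C * maxDim N T
  norm_H : frobNorm H ≤ C * rootDim N T
  inner_H_V : |frobInner H V| ≤ C * rootDim N T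
  norm_Z : ∀ k, frobNorm (Z k) ≤ C * rootDim N T
  inner_Z_V : ∀ k, |frobInner (Z k) V| ≤ C * rootDim N T
  gram_isUnit : IsUnit (gram Z).det
  gram_inv : frobNorm (gram Z)⁻¹ ≤ C / rootDim N T ^ 2
  max_V : ENNReal.ofReal (maxSq V) ≤ ENNReal.ofReal (η * rootDim N T ^ 2) * c
  max_Z : ∀ k, ENNReal.ofReal (maxSq (Z k)) ≤ ENNReal.ofReal (η * (rootDim N T ^ 2) ^ 2) * c

/-- The constant in the bounds for the candidate weight. -/
noncomputable def weightConst (K : ℕ) (C : ℝ) : ℝ := 2 * C ^ 2 * (C + K ^ 2 * C ^ 3)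

/-- The sample size from which the candidate weight is well defined. -/
noncomputable def weightDim (K : ℕ) (C : ℝ) : ℝ :=
  2 * C ^ 2 * (C + K ^ 2 * C ^ 4 + K ^ 2 * C ^ 3)

/-- The slack in the bounds on the largest entries. -/
noncomputable def entrySlack (K : ℕ) (C : ℝ) : ℝ :=
  (2 * C ^ 2 * ((1 + K) * (1 + K ^ 3 * C ^ 4)))⁻¹

lemma entrySlack_pos (K : ℕ) {C : ℝ} (hC : 0 < C) : 0 < entrySlack K C := by
  unfold entrySlack
  positivity

lemma weightConst_pos (K : ℕ) {C : ℝ} (hC : 0 < C) : 0 < weightConst K C := by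
  unfold weightConst
  positivity

lemma sv_one_sum_le {ι : Type*} (s : Finset ι) (B : ι → Mat N T) :
    sv (∑ k ∈ s, B k) 1 ≤ ∑ k ∈ s, sv (B k) 1 := by
  refine Finset.le_sum_of_subadditive (fun A : Mat N T => sv A 1) (le_of_eq ?_) sv_one_add_le s B
  refine le_antisymm ?_ (sv_nonneg _ _)
  simpa using sv_one_smul_le 0 (0 : Mat N T)

/-- Cauchy–Schwarz for K + 1 summands, indexed by `Option (Fin K)`. -/
lemma sq_sub_sum_le (v : ℝ) (x : Fin K → ℝ) :
    (v - ∑ k, x k) ^ 2 ≤ (1 + K) * (v ^ 2 + ∑ k, x k ^ 2) := by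
  have h := sq_sum_le_card_mul_sum_sq (s := Finset.univ)
    (f := fun k : Option (Fin K) => k.elim v fun k => -x k)
  simp only [Fintype.sum_option, Option.elim, Finset.sum_neg_distrib, neg_sq, Finset.card_univ,
    Fintype.card_option, Fintype.card_fin] at h
  push_cast at h
  rwa [← sub_eq_add_neg, add_comm (K : ℝ)] at h

/-- The largest entries of the residual of `V` given the controls. -/
lemma residual_entry_sq_le {C s : ℝ} (hC : 0 < C) (hs : 0 < s) {c : ℝ≥0} {V : Mat N T}
    {Z : Fin K → Mat N T} {a : Fin K → ℝ} (ha : ∀ k, |a k| ≤ K * C ^ 2 / s)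
    (hV : ENNReal.ofReal (maxSq V) ≤ ENNReal.ofReal (entrySlack K C * s ^ 2) * c)
    (hZ : ∀ k, ENNReal.ofReal (maxSq (Z k)) ≤
      ENNReal.ofReal (entrySlack K C * (s ^ 2) ^ 2) * c) (i : Fin N) (t : Fin T) :
    (V - ∑ k, a k • Z k) i t ^ 2 ≤ c * (s ^ 2 / (2 * C ^ 2)) := by
  have hη : 0 < entrySlack K C := entrySlack_pos K hC
  -- This identity dictates `entrySlack`: 1 + K comes from squaring a sum of K + 1 terms, K³C⁴ from
  -- K controls with coefficients at most KC²/s, and s²/(2C²) is the lower bound for the squared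
  -- norm of the residual.
  have hslack : (1 + K) * ((1 + K ^ 3 * C ^ 4) * (entrySlack K C * s ^ 2 * c)) =
      c * (s ^ 2 / (2 * C ^ 2)) := by
    simp only [entrySlack]
    field_simp
  generalize entrySlack K C = η at *
  have hc : (0 : ℝ) ≤ c := c.2
  have hK : (0 : ℝ) ≤ K := Nat.cast_nonneg K
  simp only [← ENNReal.ofReal_coe_nnreal] at hV hZ
  have hV1 : V i t ^ 2 ≤ η * s ^ 2 * c := by
    rw [← ENNReal.ofReal_mul (by positivity), ENNReal.ofReal_le_ofReal_iff (by positivity)] at hV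
    exact (sq_le_maxSq V i t).trans hV
  have hZ1 : ∀ k, (a k * Z k i t) ^ 2 ≤ K ^ 2 * C ^ 4 * (η * s ^ 2 * c) := by
    intro k
    have h1 := hZ k
    rw [← ENNReal.ofReal_mul (by positivity), ENNReal.ofReal_le_ofReal_iff (by positivity)] at h1
    calc (a k * Z k i t) ^ 2 = |a k| ^ 2 * Z k i t ^ 2 := by rw [mul_pow, sq_abs]
      _ ≤ (K * C ^ 2 / s) ^ 2 * (η * (s ^ 2) ^ 2 * c) :=
          mul_le_mul (pow_le_pow_left₀ (abs_nonneg _) (ha k) 2) ((sq_le_maxSq _ _ _).trans h1)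
            (sq_nonneg _) (sq_nonneg _)
      _ = _ := by field_simp
  have h2 : ∑ k, (a k * Z k i t) ^ 2 ≤ K * (K ^ 2 * C ^ 4 * (η * s ^ 2 * c)) := by
    simpa using Finset.sum_le_sum fun k (_ : k ∈ Finset.univ) => hZ1 k
  have e : (V - ∑ k, a k • Z k) i t = V i t - ∑ k, a k * Z k i t := by
    simp [Matrix.sub_apply, Matrix.sum_apply]
  rw [← hslack, e]
  refine (sq_sub_sum_le _ _).trans (mul_le_mul_of_nonneg_left ?_ (by positivity))
  calc V i t ^ 2 + ∑ k, (a k * Z k i t) ^ 2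
      ≤ η * s ^ 2 * c + K * (K ^ 2 * C ^ 4 * (η * s ^ 2 * c)) := add_le_add hV1 h2
    _ = _ := by ring

/-- The residual of `V` given the controls yields a feasible weight of the optimal order. -/
lemma DecompBound.exists_feasible {C : ℝ} (hC : 1 ≤ C) {c : ℝ≥0∞} {X : Mat N T}
    {Z : Fin K → Mat N T} {π : Fin K → ℝ} {H V : Mat N T}
    (h : DecompBound C (entrySlack K C) c X Z π H V)
    (hN : 0 < N) (hT : 0 < T) (hdim : weightDim K C ≤ rootDim N T) :
    ∃ B, Feasible c X Z B ∧ frobNorm B ≤ weightConst K C / rootDim N T ∧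
      sv B 1 ≤ weightConst K C * maxDim N T / rootDim N T ^ 2 := by
  have hC0 : 0 < C := one_pos.trans_le hC
  set s := rootDim N T
  set m := maxDim N T
  have ha1 := one_le_minDim hN hT
  have ham := minDim_le_maxDim N T
  have hm1 : 1 ≤ m := ha1.trans ham
  have hs1 : 1 ≤ s := by
    rw [← show _ = s from minDim_mul_maxDim N T]
    nlinarith
  have hs0 : 0 < s := one_pos.trans_le hs1
  have hK : (0 : ℝ) ≤ K := Nat.cast_nonneg K
  set z : Fin K → ℝ := fun j => frobInner (Z j) V
  -- Projection coefficients of V on the controls. They are of order 1/s because ⟨Z_k, V⟩ is only of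
  -- order s against a Gram matrix of order s².
  set a : Fin K → ℝ := (gram Z)⁻¹.mulVec z
  have ha : ∀ k, |a k| ≤ K * C ^ 2 / s := by
    intro k
    calc |a k| ≤ ∑ j, |(gram Z)⁻¹ k j| * |z j| := by
          have e : a k = ∑ j, (gram Z)⁻¹ k j * z j := rfl
          simp only [e, ← abs_mul]
          exact Finset.abs_sum_le_sum_abs _ _
      _ ≤ ∑ _j : Fin K, (C / s ^ 2) * (C * s) := by
          refine Finset.sum_le_sum fun j _ => ?_
          exact mul_le_mul ((abs_entry_le_frobNorm (gram Z)⁻¹ k j).trans h.gram_inv)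
            (h.inner_Z_V j) (abs_nonneg _) (by positivity)
      _ = _ := by
          simp only [Finset.sum_const, Finset.card_univ, Fintype.card_fin, nsmul_eq_mul]
          field_simp
  have hga : ∀ j, ∑ k, a k * frobInner (Z k) (Z j) = z j := by
    intro j
    have h1 : (gram Z).mulVec a = z := by
      rw [Matrix.mulVec_mulVec, Matrix.mul_nonsing_inv _ h.gram_isUnit, Matrix.one_mulVec]
    rw [← h1]
    simp [Matrix.mulVec, dotProduct, gram, frobInner_comm (Z j), mul_comm]
  set W := V - ∑ k, a k • Z k
  have hWZ : ∀ j, frobInner W (Z j) = 0 := by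
    intro j
    simp only [W, frobInner_sub_left, frobInner_sum_left, frobInner_smul_left, hga]
    rw [frobInner_comm, sub_self]
  have hsum : ∀ f : Fin K → ℝ, ∀ B : ℝ, (∀ k, |f k| ≤ B) →
      |∑ k, a k * f k| ≤ K * (K * C ^ 2 / s * B) := by
    intro f B hf
    calc |∑ k, a k * f k| ≤ ∑ k, |a k| * |f k| := by
          refine (Finset.abs_sum_le_sum_abs _ _).trans (le_of_eq ?_)
          simp only [abs_mul]
      _ ≤ ∑ _k : Fin K, (K * C ^ 2 / s) * B := by
          gcongr with k
          · exact ha k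
          · exact hf k
      _ = _ := by simp
  have hVsq : s ^ 2 / C ^ 2 ≤ frobNorm V ^ 2 := by
    rw [div_le_iff₀ (by positivity), ← mul_pow, mul_comm]
    exact pow_le_pow_left₀ hs0.le h.le_norm_V 2
  have hZV : |∑ k, a k * frobInner (Z k) V| ≤ K ^ 2 * C ^ 3 := by
    refine (hsum _ (C * s) h.inner_Z_V).trans (le_of_eq ?_)
    field_simp
  have hZH : |∑ k, a k * frobInner (Z k) H| ≤ K ^ 2 * C ^ 4 * s := by
    refine (hsum _ ((C * s) * (C * s)) fun k => ?_).trans (le_of_eq ?_)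
    · exact (abs_frobInner_le _ _).trans
        (mul_le_mul (h.norm_Z k) h.norm_H (frobNorm_nonneg _) (by positivity))
    · field_simp
  have hWV : frobInner W V = frobNorm V ^ 2 - ∑ k, a k * frobInner (Z k) V := by
    simp only [W, frobInner_sub_left, frobInner_sum_left, frobInner_smul_left, frobInner_self]
  have hWH : frobInner W H = frobInner H V - ∑ k, a k * frobInner (Z k) H := by
    simp only [W, frobInner_sub_left, frobInner_sum_left, frobInner_smul_left,
      frobInner_comm V H]
  have hWX : frobInner W X = frobInner W H + frobInner W V := by
    rw [h.decomp, frobInner_add_right, frobInner_add_right, frobInner_sum_right]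
    simp [frobInner_smul_right, hWZ]
  have hWW : frobNorm W ^ 2 = frobInner W V := by
    rw [← frobInner_self]
    nth_rewrite 2 [show W = V - ∑ k, a k • Z k from rfl]
    rw [frobInner_sub_right, frobInner_sum_right]
    simp [frobInner_smul_right, hWZ]
  -- All cross terms in ⟨W, X⟩ are at most linear in s, while ‖V‖² is at least s²/C²; `weightDim` is
  -- the size beyond which they consume at most half of it.
  have hbig : C * s + K ^ 2 * C ^ 4 * s + K ^ 2 * C ^ 3 ≤ s ^ 2 / (2 * C ^ 2) := by
    rw [le_div_iff₀ (by positivity)]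
    have h1 : weightDim K C * s ≤ s ^ 2 := by
      rw [sq]
      exact mul_le_mul_of_nonneg_right hdim hs0.le
    have h2 : K ^ 2 * C ^ 3 ≤ K ^ 2 * C ^ 3 * s := le_mul_of_one_le_right (by positivity) hs1
    unfold weightDim at h1
    have h3 : 2 * C ^ 2 * (K ^ 2 * C ^ 3) ≤ 2 * C ^ 2 * (K ^ 2 * C ^ 3 * s) := by gcongr
    linarith
  have hhalf : s ^ 2 / C ^ 2 = s ^ 2 / (2 * C ^ 2) + s ^ 2 / (2 * C ^ 2) := by
    field_simp
    ring
  have hWX_ge : s ^ 2 / (2 * C ^ 2) ≤ frobInner W X := by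
    rw [hWX, hWV, hWH]
    have := (abs_le.1 h.inner_H_V).1
    have := (abs_le.1 hZV).2
    have := (abs_le.1 hZH).2
    linarith
  have hWW_ge : s ^ 2 / (2 * C ^ 2) ≤ frobNorm W ^ 2 := by
    rw [hWW, hWV]
    have := (abs_le.1 hZV).2
    have : 0 ≤ C * s + K ^ 2 * C ^ 4 * s := by positivity
    linarith
  have hpos : 0 < frobInner W X := lt_of_lt_of_le (by positivity) hWX_ge
  -- The projection has bounded Frobenius norm, so bounding its spectral norm by the Frobenius norm
  -- keeps the order of s_1(V).
  have hsumZ : ∑ k, |a k| * frobNorm (Z k) ≤ K ^ 2 * C ^ 3 := by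
    calc ∑ k, |a k| * frobNorm (Z k) ≤ ∑ _k : Fin K, (K * C ^ 2 / s) * (C * s) := by
          gcongr with k
          · exact frobNorm_nonneg _
          · exact ha k
          · exact h.norm_Z k
      _ = _ := by
          simp only [Finset.sum_const, Finset.card_univ, Fintype.card_fin, nsmul_eq_mul]
          field_simp
  have hWn : frobNorm W ≤ (C + K ^ 2 * C ^ 3) * s := by
    calc frobNorm W ≤ frobNorm V + ∑ k, |a k| * frobNorm (Z k) := by
          refine (frobNorm_sub_le _ _).trans (add_le_add le_rfl ?_)
          exact (frobNorm_sum_le _ _).trans (Finset.sum_le_sum fun k _ => (frobNorm_smul _ _).le)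
      _ ≤ C * s + K ^ 2 * C ^ 3 := add_le_add h.norm_V hsumZ
      _ ≤ C * s + K ^ 2 * C ^ 3 * s := by
          refine add_le_add le_rfl ?_
          exact le_mul_of_one_le_right (by positivity) hs1
      _ = _ := by ring
  have hWs : sv W 1 ≤ (C + K ^ 2 * C ^ 3) * m := by
    calc sv W 1 ≤ sv V 1 + ∑ k, |a k| * frobNorm (Z k) := by
          simp only [W]
          rw [sub_eq_add_neg]
          refine (sv_one_add_le _ _).trans (add_le_add le_rfl ((sv_one_neg_le _).trans ?_))
          refine (sv_one_sum_le _ _).trans (Finset.sum_le_sum fun k _ => ?_)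
          rw [← frobNorm_smul]
          exact sv_one_le_frobNorm _
      _ ≤ C * m + K ^ 2 * C ^ 3 := add_le_add h.sn_V hsumZ
      _ ≤ C * m + K ^ 2 * C ^ 3 * m := by
          refine add_le_add le_rfl ?_
          exact le_mul_of_one_le_right (by positivity) hm1
      _ = _ := by ring
  set t := (frobInner W X)⁻¹
  have ht : 0 < t := inv_pos.2 hpos
  have ht2 : t ≤ 2 * C ^ 2 / s ^ 2 := by
    rw [← inv_div]
    exact inv_anti₀ (by positivity) hWX_ge
  refine ⟨t • W, ⟨?_, ?_, ?_⟩, ?_, ?_⟩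
  · rcases eq_or_ne c ⊤ with hc | hc
    · rw [hc]
      exact le_top
    obtain ⟨c, rfl⟩ : ∃ x : ℝ≥0, c = x := ⟨c.toNNReal, (ENNReal.coe_toNNReal hc).symm⟩
    rw [← ENNReal.ofReal_coe_nnreal]
    refine ENNReal.ofReal_le_ofReal (lind_le c.2 fun i u => ?_)
    have hW1 : W i u ^ 2 ≤ c * (s ^ 2 / (2 * C ^ 2)) :=
      residual_entry_sq_le hC0 hs0 ha h.max_V h.max_Z i u
    rw [frobNorm_smul, mul_pow, sq_abs, Matrix.smul_apply, smul_eq_mul, mul_pow]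
    have hcn : (0 : ℝ) ≤ c := c.2
    calc t ^ 2 * W i u ^ 2 ≤ t ^ 2 * (c * frobNorm W ^ 2) := by
          gcongr
          exact hW1.trans (by gcongr)
      _ = _ := by ring
  · rw [frobInner_smul_left]
    exact inv_mul_cancel₀ hpos.ne'
  · intro k
    rw [frobInner_smul_left, hWZ, mul_zero]
  · rw [frobNorm_smul, abs_of_pos ht]
    calc t * frobNorm W ≤ (2 * C ^ 2 / s ^ 2) * ((C + K ^ 2 * C ^ 3) * s) := by
          gcongr
          exact frobNorm_nonneg _
      _ = _ := by
          unfold weightConst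
          field_simp
  · refine (sv_one_smul_le _ _).trans ?_
    rw [abs_of_pos ht]
    calc t * sv W 1 ≤ (2 * C ^ 2 / s ^ 2) * ((C + K ^ 2 * C ^ 3) * m) := by
          gcongr
          exact sv_nonneg _ _
      _ = _ := by
          unfold weightConst
          field_simp

/-- Norms of the optimal weight, given a feasible weight of the optimal order. -/
lemma IsOptimalWeight.norm_le {c : ℝ≥0∞} {L : ℝ} (hL : 0 < L) {X : Mat N T}
    {Z : Fin K → Mat N T} {A B : Mat N T} (hA : IsOptimalWeight (bStar N T R) c X Z A)
    (hN : 0 < N) (hT : 0 < T) (hB : Feasible c X Z B) (h1 : frobNorm B ≤ L / rootDim N T)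
    (h2 : sv B 1 ≤ L * maxDim N T / rootDim N T ^ 2) :
    frobNorm A ≤ L * (1 + 8 * R) / minDim N T ^ 2 ∧
      4 * R * maxDim N T * sv A 1 ≤ L * (1 + 8 * R) / minDim N T ^ 2 := by
  have h := hA.2 B hB
  have hsm := minDim_mul_maxDim N T
  have ha1 := one_le_minDim hN hT
  have ham := minDim_le_maxDim N T
  set s := rootDim N T
  set m := maxDim N T
  set a := minDim N T
  have ha0 : 0 < a := one_pos.trans_le ha1
  have hm0 : 0 < m := ha0.trans_le ham
  rw [← hsm] at h1 h2
  have hR : (0 : ℝ) ≤ R := Nat.cast_nonneg R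
  -- The tuning parameter is R m up to constants, so the penalty on B, R m · m/s², has order R/a²
  -- because s = a m. The upper bound yields the factor 1 + 8R, the lower one returns to s_1(A).
  have hb1 : bStar N T R ≤ 8 * R * m := by
    have h3 : √(N : ℝ) ≤ m := le_max_left _ _
    have h4 : √(T : ℝ) ≤ m := le_max_right _ _
    unfold bStar
    nlinarith
  have hb2 : 4 * R * m ≤ bStar N T R := by
    have h3 : m ≤ √(N : ℝ) + √(T : ℝ) :=
      max_le (le_add_of_nonneg_right (Real.sqrt_nonneg _))
        (le_add_of_nonneg_left (Real.sqrt_nonneg _))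
    unfold bStar
    gcongr
  have hb0 : 0 ≤ bStar N T R := le_trans (by positivity) hb2
  have hB1 : frobNorm B ≤ L / a ^ 2 := by
    refine h1.trans ?_
    rw [sq]
    gcongr
  have hB2 : bStar N T R * sv B 1 ≤ 8 * R * (L / a ^ 2) := by
    calc bStar N T R * sv B 1 ≤ (8 * R * m) * (L * m / (a * m) ^ 2) := by
          gcongr
          exact sv_nonneg _ _
      _ = _ := by field_simp
  have hobj : weightObj (bStar N T R) B ≤ (L * (1 + 8 * R) / a ^ 2) ^ 2 := by
    have e1 := pow_le_pow_left₀ (frobNorm_nonneg _) hB1 2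
    have e2 := pow_le_pow_left₀ (mul_nonneg hb0 (sv_nonneg _ _)) hB2 2
    rw [weightObj, ← mul_pow]
    refine (add_le_add e1 e2).trans ?_
    have e3 : L * (1 + 8 * R) / a ^ 2 = L / a ^ 2 + 8 * R * (L / a ^ 2) := by ring
    have e4 : 0 ≤ 2 * (L / a ^ 2) * (8 * R * (L / a ^ 2)) := by positivity
    rw [e3]
    nlinarith
  have hA1 := h.trans hobj
  rw [weightObj, ← mul_pow] at hA1
  have hn : 0 ≤ L * (1 + 8 * R) / a ^ 2 := by positivity
  refine ⟨le_of_sq_le_sq (by nlinarith [sq_nonneg (bStar N T R * sv A 1)]) hn, ?_⟩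
  refine le_trans (mul_le_mul_of_nonneg_right hb2 (sv_nonneg _ _)) ?_
  exact le_of_sq_le_sq (by nlinarith [sq_nonneg (frobNorm A)]) hn

end Weights

/-! ### Deterministic error bounds for the algorithm. -/

section Estimator

variable {N T K R : ℕ}

lemma frobInner_lin (A X : Mat N T) (Z : Fin K → Mat N T) (g : ℝ × (Fin K → ℝ)) :
    frobInner A (lin X Z g) = g.1 * frobInner A X + ∑ k, g.2 k * frobInner A (Z k) := by
  simp [lin, frobInner_add_right, frobInner_sum_right, frobInner_smul_right]

lemma Feasible.frobInner_lin {c : ℝ≥0∞} {A X : Mat N T} {Z : Fin K → Mat N T}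
    (h : Feasible c X Z A) (g : ℝ × (Fin K → ℝ)) : frobInner A (lin X Z g) = g.1 := by
  simp [FactorPanel.frobInner_lin, h.2.1, h.2.2]

lemma Feasible.frobInner_lin_update {c : ℝ≥0∞} {A X : Mat N T} {Z : Fin K → Mat N T} {j : Fin K}
    (h : Feasible c (Z j) (Function.update Z j X) A) (g : ℝ × (Fin K → ℝ)) :
    frobInner A (lin X Z g) = g.2 j := by
  have h1 : frobInner A X = 0 := by simpa using h.2.2 j
  have h2 : ∀ k, k ≠ j → frobInner A (Z k) = 0 := fun k hk => by simpa [hk] using h.2.2 k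
  rw [FactorPanel.frobInner_lin, h1, mul_zero, zero_add,
    Finset.sum_eq_single j (fun k _ hk => by rw [h2 k hk, mul_zero]) (by simp), h.2.1, mul_one]

/-- Bounds, for given data, on the regressors, the factor component and the noise. -/
structure ModelBound (R : ℕ) (C s η : ℝ) (X : Mat N T) (Z : Fin K → Mat N T) (G U : Mat N T) :
    Prop where
  rank_le : G.rank ≤ R
  nonCollinear : NonCollinear R s X Z
  norm_X : frobNorm X ≤ C * rootDim N T
  norm_Z : ∀ k, frobNorm (Z k) ≤ C * rootDim N T
  ex_X : |frobInner X U| ≤ C * rootDim N T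
  ex_Z : ∀ k, |frobInner (Z k) U| ≤ C * rootDim N T
  sn_U : sv U 1 ≤ C * maxDim N T
  le_sn_U : maxDim N T ≤ C * sv U 1
  gap : sv U 1 - sv U (2 * R + 1) ≤ η * sv U 1

/-- Bounds on a weight matrix. -/
structure WeightBound (R : ℕ) (C L : ℝ) (U A : Mat N T) : Prop where
  norm_le : frobNorm A ≤ L / minDim N T ^ 2
  sn_le : 4 * R * maxDim N T * sv A 1 ≤ L / minDim N T ^ 2
  noise_le : |frobInner A U| ≤ C * frobNorm A

/-- The constant in the rate of the low rank component in least squares. -/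
noncomputable def lsConst (K R : ℕ) (C s : ℝ) : ℝ :=
  (1 + (K + 1) * C / √s) *
    (2 * ((K + 1) * C / √s) + 2 * √(2 * R) * C * (1 + (K + 1) * C / √s))

/-- The constant in the rate of the preliminary coefficients. -/
noncomputable def preConst (K R : ℕ) (C s L : ℝ) : ℝ := L * lsConst K R C s + C * L

/-- The constant in the rate of the fitted values of the preliminary coefficients. -/
noncomputable def fitConst (K R : ℕ) (C s L : ℝ) : ℝ := (K + 1) * (preConst K R C s L * C)

lemma lsConst_nonneg (K R : ℕ) {C : ℝ} (hC : 0 ≤ C) (s : ℝ) : 0 ≤ lsConst K R C s := by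
  unfold lsConst
  positivity

lemma preConst_nonneg (K R : ℕ) {C L : ℝ} (hC : 0 ≤ C) (hL : 0 ≤ L) (s : ℝ) :
    0 ≤ preConst K R C s L := by
  have := lsConst_nonneg K R hC s
  unfold preConst
  positivity

lemma fitConst_nonneg (K R : ℕ) {C L : ℝ} (hC : 0 ≤ C) (hL : 0 ≤ L) (s : ℝ) :
    0 ≤ fitConst K R C s L := by
  have := preConst_nonneg K R hC hL s
  unfold fitConst
  positivity

/-- Crude, but it matches the factor 4R in `WeightBound.sn_le`. For R = 0 the weight problem does
not penalize s_1(A), and the factor must vanish. -/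
lemma sqrt_two_mul_natCast_le (R : ℕ) : √(2 * R : ℝ) ≤ 4 * R := by
  rcases Nat.eq_zero_or_pos R with rfl | hR
  · simp
  · have : (1 : ℝ) ≤ R := by exact_mod_cast hR
    exact Real.sqrt_le_iff.2 ⟨by positivity, by nlinarith⟩

lemma WeightBound.abs_frobInner_le {C L B : ℝ} {U A D : Mat N T} (h : WeightBound R C L U A)
    (hD : D.rank ≤ 2 * R) (hB : 0 ≤ B)
    (hDn : frobNorm D ≤ B * maxDim N T) : |frobInner A D| ≤ L * B / minDim N T ^ 2 := by
  have h1 := abs_frobInner_le_of_rank_le A hD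
  push_cast at h1
  calc |frobInner A D| ≤ sv A 1 * (4 * R * (B * maxDim N T)) := by
        refine h1.trans (mul_le_mul_of_nonneg_left ?_ (sv_nonneg _ _))
        exact mul_le_mul (sqrt_two_mul_natCast_le R) hDn (frobNorm_nonneg _) (by positivity)
    _ = B * (4 * R * maxDim N T * sv A 1) := by ring
    _ ≤ B * (L / minDim N T ^ 2) := mul_le_mul_of_nonneg_left h.sn_le hB
    _ = _ := by ring

lemma WeightBound.abs_noise_le {C L : ℝ} {U A : Mat N T} (h : WeightBound R C L U A)
    (hC : 0 ≤ C) : |frobInner A U| ≤ C * L / minDim N T ^ 2 := by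
  refine h.noise_le.trans ?_
  rw [mul_div_assoc]
  exact mul_le_mul_of_nonneg_left h.norm_le hC

variable {C s η L : ℝ} {c : ℝ≥0∞} {X G U : Mat N T} {Z : Fin K → Mat N T}

namespace Implementation

variable (I : Implementation N T K R c)

lemma frobNorm_gammaLS_error_le (h : ModelBound R C s η X Z G U) (hC : 0 ≤ C) (hs : 0 < s)
    (hN : 0 < N) (hT : 0 < T) (θ : ℝ × (Fin K → ℝ)) :
    (I.gammaLS (lin X Z θ + G + U) X Z).rank ≤ R ∧
      frobNorm (G - I.gammaLS (lin X Z θ + G + U) X Z) ≤ lsConst K R C s * maxDim N T := by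
  have hopt := I.ls_optimal (lin X Z θ + G + U) X Z
    (h.nonCollinear.exists_isLeastSquares hs hN hT I.lowRank I.lowRank_optimal _)
  exact ⟨hopt.1, hopt.frobNorm_error_le hs ((one_le_minDim hN hT).trans (minDim_le_maxDim N T))
    h.nonCollinear hN hT h.rank_le hC h.norm_X h.norm_Z h.ex_X h.ex_Z h.sn_U⟩

/-- The error is ⟨A, Γ - Γ̂_LS⟩ + ⟨A, U⟩, both of order 1/min{N,T}. Stated for a general weight A so
that it serves β̂_pre and every δ̂_pre,j: pairing A with `lin X Z θ` selects the coefficient in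
question. -/
lemma abs_coefPre_error_le (h : ModelBound R C s η X Z G U) (hC : 0 ≤ C) (hs : 0 < s)
    (hN : 0 < N) (hT : 0 < T) (θ : ℝ × (Fin K → ℝ)) {A : Mat N T}
    (hA : WeightBound R C L U A) :
    |frobInner A (lin X Z θ + G + U - I.gammaLS (lin X Z θ + G + U) X Z)
      - frobInner A (lin X Z θ)| ≤ preConst K R C s L / minDim N T ^ 2 := by
  obtain ⟨hr, hn⟩ := I.frobNorm_gammaLS_error_le h hC hs hN hT θ
  set Gh := I.gammaLS (lin X Z θ + G + U) X Z
  have e : frobInner A (lin X Z θ + G + U - Gh) - frobInner A (lin X Z θ) =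
      frobInner A (G - Gh) + frobInner A U := by
    rw [← frobInner_sub_right, ← frobInner_add_right]
    congr 1
    abel
  rw [e, preConst, add_div]
  exact (abs_add_le _ _).trans (add_le_add
    (hA.abs_frobInner_le (rank_sub_le h.rank_le hr) (lsConst_nonneg K R hC s) hn)
    (hA.abs_noise_le hC))

/-- Coefficient errors of order 1/a² meet regressors of norm √(NT) = a m, where a = `minDim N T` and
m = `maxDim N T`. The product m/a is of smaller order than s_1(U), which is of order m. -/
lemma frobNorm_fit_error_le (h : ModelBound R C s η X Z G U) (hC : 0 ≤ C) (hs : 0 < s)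
    (hN : 0 < N) (hT : 0 < T) (θ : ℝ × (Fin K → ℝ))
    (hf : Feasible c X Z (I.weight X Z)) (hw : WeightBound R C L U (I.weight X Z))
    (hf' : ∀ j, Feasible c (Z j) (Function.update Z j X)
      (I.weight (Z j) (Function.update Z j X)))
    (hw' : ∀ j, WeightBound R C L U (I.weight (Z j) (Function.update Z j X))) :
    frobNorm (lin X Z (θ - I.coefPre (lin X Z θ + G + U) X Z)) ≤
      fitConst K R C s L * maxDim N T / minDim N T := by
  have ha := one_le_minDim hN hT
  refine (frobNorm_lin_le (r := preConst K R C s L / minDim N T ^ 2) h.norm_X h.norm_Z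
    ?_ fun j => ?_).trans (le_of_eq ?_)
  · rw [Prod.fst_sub, abs_sub_comm, ← hf.frobInner_lin θ]
    exact I.abs_coefPre_error_le h hC hs hN hT θ hw
  · rw [Prod.snd_sub, Pi.sub_apply, abs_sub_comm, ← (hf' j).frobInner_lin_update θ]
    exact I.abs_coefPre_error_le h hC hs hN hT θ (hw' j)
  · rw [fitConst, ← minDim_mul_maxDim]
    have : minDim N T ≠ 0 := by positivity
    field_simp

/-- The error of `β̂` is the noise term up to a bias bounded by the spectral norms of the weight
and of the noise. -/
lemma abs_betaHat_error_sub_noise_le (h : ModelBound R C s η X Z G U)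
    (θ : ℝ × (Fin K → ℝ)) (hf : Feasible c X Z (I.weight X Z)) {w : ℝ}
    (hw : frobNorm (lin X Z (θ - I.coefPre (lin X Z θ + G + U) X Z)) ≤ w) :
    |I.betaHat (lin X Z θ + G + U) X Z - θ.1 - frobInner (I.weight X Z) U| ≤
      4 * R * (sv U 1 + w) * sv (I.weight X Z) 1 := by
  set Y := lin X Z θ + G + U
  set A := I.weight X Z
  set Δ := lin X Z (θ - I.coefPre Y X Z)
  -- The fit sees the factor component plus noise U + Δ. One √(2R) comes from the fit error and one
  -- from duality, which explains the constant 4R.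
  have eY : Y - lin X Z (I.coefPre Y X Z) = G + (U + Δ) := by
    simp only [Y, Δ, lin_sub]
    abel
  have hfit := I.lowRank_optimal (Y - lin X Z (I.coefPre Y X Z))
  change IsLowRankFit R _ (I.gammaPre Y X Z) at hfit
  rw [eY] at hfit
  set Gh := I.gammaPre Y X Z
  have e : I.betaHat Y X Z - θ.1 - frobInner A U = frobInner A (G - Gh) := by
    rw [betaHat, ← hf.frobInner_lin θ, ← frobInner_sub_right, ← frobInner_sub_right]
    congr 1
    simp only [Y]
    abel
  have h1 := abs_frobInner_le_of_rank_le A (rank_sub_le h.rank_le hfit.1)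
  push_cast at h1
  have h2 := hfit.frobNorm_error_le h.rank_le
  have h3 : sv (U + Δ) 1 ≤ sv U 1 + w :=
    (sv_one_add_le _ _).trans (add_le_add le_rfl ((sv_one_le_frobNorm _).trans hw))
  have h4 : √(2 * R : ℝ) * √(2 * R) = 2 * R := Real.mul_self_sqrt (by positivity)
  rw [e]
  calc |frobInner A (G - Gh)| ≤ sv A 1 * (√(2 * R) * (2 * √(2 * R) * (sv U 1 + w))) := by
        refine h1.trans (mul_le_mul_of_nonneg_left ?_ (sv_nonneg _ _))
        refine mul_le_mul_of_nonneg_left (h2.trans ?_) (Real.sqrt_nonneg _)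
        exact mul_le_mul_of_nonneg_left h3 (by positivity)
    _ = 2 * (√(2 * R) * √(2 * R)) * (sv U 1 + w) * sv A 1 := by ring
    _ = _ := by rw [h4]; ring

/-- Û_pre - Δ differs from U by a matrix of rank at most 2R, which can remove at most the 2R leading
singular values of U. -/
lemma sv_le_sv_residPre (h : ModelBound R C s η X Z G U)
    (θ : ℝ × (Fin K → ℝ)) {w : ℝ}
    (hw : frobNorm (lin X Z (θ - I.coefPre (lin X Z θ + G + U) X Z)) ≤ w) :
    sv U (2 * R + 1) ≤ sv (I.residPre (lin X Z θ + G + U) X Z) 1 + w := by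
  set Y := lin X Z θ + G + U
  set Δ := lin X Z (θ - I.coefPre Y X Z)
  have hr : (I.gammaPre Y X Z).rank ≤ R := (I.lowRank_optimal _).1
  refine (sv_le_sv_one_add (D := G - I.gammaPre Y X Z) (rank_sub_le h.rank_le hr)).trans ?_
  have e : U + (G - I.gammaPre Y X Z) = I.residPre Y X Z + -Δ := by
    simp only [residPre, Δ, lin_sub, Y]
    abel
  rw [e]
  exact (sv_one_add_le _ _).trans
    (add_le_add le_rfl ((sv_one_neg_le _).trans ((sv_one_le_frobNorm _).trans hw)))

/-- The rate of `β̂`. -/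
lemma abs_betaHat_error_le (h : ModelBound R C s η X Z G U) (hC : 0 ≤ C) (hs : 0 < s)
    (hL : 0 ≤ L) (hN : 0 < N) (hT : 0 < T) (θ : ℝ × (Fin K → ℝ))
    (hf : Feasible c X Z (I.weight X Z)) (hw : WeightBound R C L U (I.weight X Z))
    (hf' : ∀ j, Feasible c (Z j) (Function.update Z j X)
      (I.weight (Z j) (Function.update Z j X)))
    (hw' : ∀ j, WeightBound R C L U (I.weight (Z j) (Function.update Z j X))) :
    |I.betaHat (lin X Z θ + G + U) X Z - θ.1| ≤
      ((C + fitConst K R C s L) * L + C * L) / minDim N T ^ 2 := by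
  have ha := one_le_minDim hN hT
  have hm := ha.trans (minDim_le_maxDim N T)
  have hQ := fitConst_nonneg K R hC hL s
  have h1 := I.abs_betaHat_error_sub_noise_le h θ hf
    (I.frobNorm_fit_error_le h hC hs hN hT θ hf hw hf' hw')
  have h2 := hw.abs_noise_le hC
  have h3 : sv U 1 + fitConst K R C s L * maxDim N T / minDim N T ≤
      (C + fitConst K R C s L) * maxDim N T := by
    rw [add_mul]
    exact add_le_add h.sn_U (div_le_self (by positivity) ha)
  have h4 : 4 * R * (sv U 1 + fitConst K R C s L * maxDim N T / minDim N T) *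
      sv (I.weight X Z) 1 ≤ (C + fitConst K R C s L) * L / minDim N T ^ 2 := by
    calc _ ≤ 4 * R * ((C + fitConst K R C s L) * maxDim N T) * sv (I.weight X Z) 1 := by
          gcongr
          exact sv_nonneg _ _
      _ = (C + fitConst K R C s L) * (4 * R * maxDim N T * sv (I.weight X Z) 1) := by ring
      _ ≤ (C + fitConst K R C s L) * (L / minDim N T ^ 2) :=
          mul_le_mul_of_nonneg_left hw.sn_le (by positivity)
      _ = _ := by ring
  rw [add_div]
  have h5 : I.betaHat (lin X Z θ + G + U) X Z - θ.1 =
      (I.betaHat (lin X Z θ + G + U) X Z - θ.1 - frobInner (I.weight X Z) U) +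
        frobInner (I.weight X Z) U := by ring
  rw [h5]
  exact (abs_add_le _ _).trans (add_le_add (h1.trans h4) h2)

/-- The estimated worst-case bias dominates the bias of `β̂`. -/
lemma abs_betaHat_error_sub_noise_le_biasBar {ε : ℝ} (hε : 0 < ε)
    (h : ModelBound R C s (ε / (3 + 2 * ε)) X Z G U) (hC : 0 < C) (hs : 0 < s)
    (hL : 0 ≤ L) (hN : 0 < N) (hT : 0 < T) (θ : ℝ × (Fin K → ℝ))
    (hf : Feasible c X Z (I.weight X Z)) (hw : WeightBound R C L U (I.weight X Z))
    (hf' : ∀ j, Feasible c (Z j) (Function.update Z j X)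
      (I.weight (Z j) (Function.update Z j X)))
    (hw' : ∀ j, WeightBound R C L U (I.weight (Z j) (Function.update Z j X)))
    (hdim : fitConst K R C s L * C / (ε / (3 + 2 * ε)) ≤ minDim N T) :
    |I.betaHat (lin X Z θ + G + U) X Z - θ.1 - frobInner (I.weight X Z) U| ≤
      I.biasBar ε (lin X Z θ + G + U) X Z := by
  have ha : 0 < minDim N T := one_pos.trans_le (one_le_minDim hN hT)
  have hQ := fitConst_nonneg K R hC.le hL s
  have hU := sv_nonneg U 1
  have hfit := I.frobNorm_fit_error_le h hC.le hs hN hT θ hf hw hf' hw'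
  -- The solution of (1 - 2η)(1 + ε) = 1 + η. One η pays for the gap between s_1(U) and s_{2R+1}(U);
  -- the other bounds the fit error relative to s_1(U), both in the residual and in the bias.
  set η := ε / (3 + 2 * ε)
  have hη : 0 < η := by positivity
  have hηε : η * (3 + 2 * ε) = ε := div_mul_cancel₀ _ (by positivity)
  have hw1 : fitConst K R C s L * maxDim N T / minDim N T ≤ η * sv U 1 := by
    rw [div_le_iff₀ hη] at hdim
    rw [div_le_iff₀ ha]
    calc fitConst K R C s L * maxDim N T ≤ fitConst K R C s L * (C * sv U 1) :=
          mul_le_mul_of_nonneg_left h.le_sn_U hQ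
      _ = fitConst K R C s L * C * sv U 1 := by ring
      _ ≤ minDim N T * η * sv U 1 := mul_le_mul_of_nonneg_right hdim hU
      _ = _ := by ring
  have hfit' := hfit.trans hw1
  refine (I.abs_betaHat_error_sub_noise_le h θ hf hfit').trans ?_
  have h1 := I.sv_le_sv_residPre h θ hfit'
  rw [biasBar, cHat]
  refine mul_le_mul_of_nonneg_right ?_ (sv_nonneg _ _)
  rw [mul_assoc (4 * (R : ℝ))]
  refine mul_le_mul_of_nonneg_left ?_ (by positivity)
  have h2 : (1 - 2 * η) * sv U 1 ≤ sv (I.residPre (lin X Z θ + G + U) X Z) 1 := by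
    linarith [h.gap]
  calc sv U 1 + η * sv U 1 = (1 - 2 * η) * sv U 1 * (1 + ε) := by
        linear_combination sv U 1 * hηε
    _ ≤ _ := mul_le_mul_of_nonneg_right h2 (by positivity)

end Implementation

end Estimator

/-! ### Uniform stochastic orders as high probability bounds. -/

namespace PanelSeq

section Tight

variable {K : ℕ} (M : PanelSeq K)

/-- `Q` eventually holds with probability at least `1 - δ`, uniformly over `Θ, 𝒫`. -/
def Whp (δ : ℝ≥0∞) (Q : ∀ n, ProbabilityMeasure (M.Ω n) → ℝ × (Fin K → ℝ) → M.Ω n → Prop) :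
    Prop :=
  ∀ᶠ n in atTop, ∀ P ∈ M.Pr n, ∀ θ ∈ M.Par n, (P : Measure (M.Ω n)) {ω | ¬ Q n P θ ω} ≤ δ

/-- For large constants `C`, the property `Q C` eventually holds with probability close to one,
uniformly over `Θ, 𝒫`. -/
def Tight (Q : ℝ → ∀ n, ProbabilityMeasure (M.Ω n) → ℝ × (Fin K → ℝ) → M.Ω n → Prop) : Prop :=
  ∀ δ : ℝ≥0∞, 0 < δ → ∃ C₀ : ℝ, ∀ C, C₀ ≤ C → M.Whp δ (Q C)

variable {M} {Q Q' : ℝ → ∀ n, ProbabilityMeasure (M.Ω n) → ℝ × (Fin K → ℝ) → M.Ω n → Prop}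

lemma Whp.mono {δ : ℝ≥0∞}
    {Q Q' : ∀ n, ProbabilityMeasure (M.Ω n) → ℝ × (Fin K → ℝ) → M.Ω n → Prop}
    (h : M.Whp δ Q)
    (hQ : ∀ᶠ n in atTop, ∀ P ∈ M.Pr n, ∀ θ ∈ M.Par n, ∀ ω, Q n P θ ω → Q' n P θ ω) :
    M.Whp δ Q' := by
  filter_upwards [h, hQ] with n h1 h2 P hP θ hθ
  exact (measure_mono fun ω (hω : ¬ _) hq => hω (h2 P hP θ hθ ω hq)).trans (h1 P hP θ hθ)

/-- A common constant exists because `Tight` asks for every C beyond C₀. Properties need not be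
monotone in C: in `DecompBound` the entry slack shrinks as C grows. -/
lemma Tight.and (h : M.Tight Q) (h' : M.Tight Q') :
    M.Tight fun C n P θ ω => Q C n P θ ω ∧ Q' C n P θ ω := by
  intro δ hδ
  obtain ⟨C₁, h1⟩ := h (δ / 2) (ENNReal.half_pos hδ.ne')
  obtain ⟨C₂, h2⟩ := h' (δ / 2) (ENNReal.half_pos hδ.ne')
  refine ⟨max C₁ C₂, fun C hC => ?_⟩
  filter_upwards [h1 C ((le_max_left _ _).trans hC), h2 C ((le_max_right _ _).trans hC)]
    with n e1 e2 P hP θ hθ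
  calc (P : Measure (M.Ω n)) {ω | ¬ (Q C n P θ ω ∧ Q' C n P θ ω)}
      ≤ (P : Measure (M.Ω n)) ({ω | ¬ Q C n P θ ω} ∪ {ω | ¬ Q' C n P θ ω}) :=
        measure_mono fun ω hω => not_and_or.1 hω
    _ ≤ δ / 2 + δ / 2 := (measure_union_le _ _).trans (add_le_add (e1 P hP θ hθ) (e2 P hP θ hθ))
    _ = δ := ENNReal.add_halves δ

lemma Tight.forall_fin {m : ℕ}
    {Q : Fin m → ℝ → ∀ n, ProbabilityMeasure (M.Ω n) → ℝ × (Fin K → ℝ) → M.Ω n → Prop}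
    (h : ∀ k, M.Tight (Q k)) : M.Tight fun C n P θ ω => ∀ k, Q k C n P θ ω := by
  induction m with
  | zero => exact fun δ _ => ⟨0, fun C _ => Eventually.of_forall fun n P _ θ _ => by simp⟩
  | succ m ih =>
    simp only [Fin.forall_fin_succ]
    exact (h 0).and (ih fun k => h k.succ)

lemma Tight.mono (h : M.Tight Q) (hQ : ∀ C, 1 ≤ C → ∀ᶠ n in atTop, ∀ P ∈ M.Pr n,
    ∀ θ ∈ M.Par n, ∀ ω, Q C n P θ ω → Q' C n P θ ω) : M.Tight Q' := by
  intro δ hδ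
  obtain ⟨C₀, h1⟩ := h δ hδ
  exact ⟨max C₀ 1, fun C hC => (h1 C ((le_max_left _ _).trans hC)).mono
    (hQ C ((le_max_right _ _).trans hC))⟩

/-- For conclusions whose constant φ C is derived from the constant of the premise: the premise is
frozen at one C and the conclusion holds for all larger constants. -/
lemma Tight.mono_const (h : M.Tight Q) (φ : ℝ → ℝ)
    (hQ : ∀ C, 1 ≤ C → ∀ C', φ C ≤ C' → ∀ᶠ n in atTop, ∀ P ∈ M.Pr n,
      ∀ θ ∈ M.Par n, ∀ ω, Q C n P θ ω → Q' C' n P θ ω) : M.Tight Q' := by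
  intro δ hδ
  obtain ⟨C₀, h1⟩ := h δ hδ
  exact ⟨φ (max C₀ 1), fun C hC => (h1 _ (le_max_left _ _)).mono (hQ _ (le_max_right _ _) C hC)⟩

lemma tight_of_ae {Q : ∀ n, ProbabilityMeasure (M.Ω n) → M.Ω n → Prop}
    (h : ∀ n, ∀ P ∈ M.Pr n, ∀ᵐ ω ∂(P : Measure (M.Ω n)), Q n P ω) :
    M.Tight fun _ n P _ ω => Q n P ω :=
  fun _ _ => ⟨0, fun _ _ => Eventually.of_forall fun n P hP _ _ =>
    (ae_iff.1 (h n P hP)).trans_le (zero_le)⟩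

lemma tight_of_tendsto {Q : ∀ n, M.Ω n → Prop}
    (h : Tendsto (fun n => ⨆ P ∈ M.Pr n, (P : Measure (M.Ω n)) {ω | ¬ Q n ω}) atTop (𝓝 0)) :
    M.Tight fun _ n _ _ ω => Q n ω :=
  fun _ hδ => ⟨0, fun _ _ => (h.eventually_lt_const hδ).mono fun n hn P hP _ _ =>
    (le_iSup₂ (f := fun P (_ : P ∈ M.Pr n) => (P : Measure (M.Ω n)) {ω | ¬ Q n ω}) P hP).trans
      hn.le⟩

lemma le_supProb {n : ℕ} (E : ProbabilityMeasure (M.Ω n) → ℝ × (Fin K → ℝ) → Set (M.Ω n))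
    {P : ProbabilityMeasure (M.Ω n)} (hP : P ∈ M.Pr n) {θ : ℝ × (Fin K → ℝ)}
    (hθ : θ ∈ M.Par n) : (P : Measure (M.Ω n)) (E P θ) ≤ M.supProb n E :=
  (le_iSup₂ (f := fun θ (_ : θ ∈ M.Par n) => (P : Measure (M.Ω n)) (E P θ)) θ hθ).trans
    (le_iSup₂ (f := fun P (_ : P ∈ M.Pr n) => ⨆ θ ∈ M.Par n, (P : Measure (M.Ω n)) (E P θ)) P hP)

variable {A : ∀ n, ProbabilityMeasure (M.Ω n) → ℝ × (Fin K → ℝ) → M.Ω n → ℝ≥0∞}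
  {f : ∀ n, ProbabilityMeasure (M.Ω n) → ℝ × (Fin K → ℝ) → M.Ω n → ℝ} {r : ℕ → ℝ≥0∞}
  {ρ : ℕ → ℝ}

lemma BigO.tight (h : M.BigO A r) :
    M.Tight fun C n P θ ω => (r n)⁻¹ * A n P θ ω ≤ ENNReal.ofReal C := by
  intro δ hδ
  -- A level strictly below δ turns the bound on the limsup into an eventual bound by δ.
  obtain ⟨ε, hε, hεδ⟩ := ENNReal.lt_iff_exists_nnreal_btwn.1 hδ
  obtain ⟨C, hC⟩ := h ε (by exact_mod_cast hε)
  refine ⟨C, fun C' hC' => (eventually_lt_of_limsup_lt (hC.trans_lt hεδ)).mono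
    fun n hn P hP θ hθ => le_trans (measure_mono fun ω hω => ?_)
      ((M.le_supProb _ hP hθ).trans hn.le)⟩
  refine le_trans ?_ (not_le.1 hω).le
  rw [← ENNReal.ofReal_coe_nnreal]
  exact ENNReal.ofReal_le_ofReal hC'

lemma LittleO.tight (h : M.LittleO A r) {η : ℝ → ℝ} (hη : ∀ C, 1 ≤ C → 0 < η C) :
    M.Tight fun C n P θ ω => (r n)⁻¹ * A n P θ ω ≤ ENNReal.ofReal (η C) := by
  intro δ hδ
  refine ⟨1, fun C hC => ((h (η C).toNNReal (Real.toNNReal_pos.2 (hη C hC))).eventually_lt_const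
    hδ).mono fun n hn P hP θ hθ => le_trans (measure_mono fun ω hω => ?_)
      ((M.le_supProb _ hP hθ).trans hn.le)⟩
  exact (not_le.1 hω).le

lemma enorm_le_of_scaled_le {C ρ x : ℝ} (hρ : 0 < ρ) (hC : 0 ≤ C)
    (h : (ENNReal.ofReal ρ)⁻¹ * ‖x‖ₑ ≤ ENNReal.ofReal C) : |x| ≤ C * ρ := by
  rw [mul_comm, ← div_eq_mul_inv, ENNReal.div_le_iff (by simpa using hρ) ENNReal.ofReal_ne_top,
    ← ENNReal.ofReal_mul hC, Real.enorm_eq_ofReal_abs,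
    ENNReal.ofReal_le_ofReal_iff (by positivity)] at h
  exact h

lemma BigO.tight_abs (h : M.BigO (fun n P θ ω => ‖f n P θ ω‖ₑ) r)
    (hr : ∀ n, r n = ENNReal.ofReal (ρ n)) (hρ : ∀ᶠ n in atTop, 0 < ρ n) :
    M.Tight fun C n P θ ω => |f n P θ ω| ≤ C * ρ n :=
  h.tight.mono fun C hC => hρ.mono fun n hn P _ θ _ ω hω =>
    enorm_le_of_scaled_le hn (by linarith) (by rwa [hr] at hω)

lemma Asymp.tight_le (h : M.Asymp (fun n P θ ω => ‖f n P θ ω‖ₑ) r)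
    (hr : ∀ n, r n = ENNReal.ofReal (ρ n)) (hρ : ∀ᶠ n in atTop, 0 < ρ n) :
    M.Tight fun C n P θ ω => ρ n ≤ C * |f n P θ ω| := by
  refine h.2.tight.mono fun C hC => hρ.mono fun n hn P _ θ _ ω hω => ?_
  simp only [inv_inv, hr, ← div_eq_mul_inv] at hω
  have hC0 : 0 ≤ C := by linarith
  -- A zero value has infinite inverse, which the bound on the inverse excludes.
  have h0 : ‖f n P θ ω‖ₑ ≠ 0 := by
    intro h0
    rw [h0, ENNReal.div_zero (by simpa using hn)] at hω
    exact ENNReal.ofReal_ne_top (top_le_iff.1 hω)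
  rw [ENNReal.div_le_iff h0 enorm_ne_top, Real.enorm_eq_ofReal_abs, ← ENNReal.ofReal_mul hC0,
    ENNReal.ofReal_le_ofReal_iff (by positivity)] at hω
  exact hω

variable (M)

lemma eventually_pos : ∀ᶠ n in atTop, 0 < M.N n ∧ 0 < M.T n :=
  (M.tendsto_N.eventually_gt_atTop 0).and (M.tendsto_T.eventually_gt_atTop 0)

lemma eventually_rootDim_pos : ∀ᶠ n in atTop, 0 < rootDim (M.N n) (M.T n) :=
  M.eventually_pos.mono fun n hn => by
    have h1 : (0 : ℝ) < M.N n := by exact_mod_cast hn.1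
    have h2 : (0 : ℝ) < M.T n := by exact_mod_cast hn.2
    unfold rootDim
    positivity

lemma eventually_maxDim_pos : ∀ᶠ n in atTop, 0 < maxDim (M.N n) (M.T n) :=
  M.eventually_pos.mono fun _ hn =>
    one_pos.trans_le ((one_le_minDim hn.1 hn.2).trans (minDim_le_maxDim _ _))

lemma tendsto_minDim : Tendsto (fun n => minDim (M.N n) (M.T n)) atTop atTop :=
  tendsto_atTop.2 fun x =>
    (((Real.tendsto_sqrt_atTop.comp
      (tendsto_natCast_atTop_atTop.comp M.tendsto_N)).eventually_ge_atTop x).and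
    ((Real.tendsto_sqrt_atTop.comp
      (tendsto_natCast_atTop_atTop.comp M.tendsto_T)).eventually_ge_atTop x)).mono
    fun _ h => le_min h.1 h.2

lemma eventually_le_rootDim (x : ℝ) : ∀ᶠ n in atTop, x ≤ rootDim (M.N n) (M.T n) := by
  filter_upwards [M.eventually_pos, M.tendsto_minDim.eventually_ge_atTop x] with n hn hx
  rw [← minDim_mul_maxDim]
  have h1 := one_le_minDim hn.1 hn.2
  have h2 := h1.trans (minDim_le_maxDim _ _)
  exact hx.trans (le_mul_of_one_le_right (by linarith) h2)

lemma rootNT_eq (n : ℕ) : M.rootNT n = ENNReal.ofReal (rootDim (M.N n) (M.T n)) := rfl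

lemma maxRoot_eq (n : ℕ) : M.maxRoot n = ENNReal.ofReal (maxDim (M.N n) (M.T n)) := rfl

lemma prodNT_eq (n : ℕ) : M.prodNT n = ENNReal.ofReal (rootDim (M.N n) (M.T n) ^ 2) := by
  rw [rootDim, Real.sq_sqrt (by positivity), ENNReal.ofReal_mul (by positivity), prodNT]
  simp

end Tight

section Decomposition

variable {K : ℕ} {M : PanelSeq K} {c : ℕ → ℝ≥0∞}
  {X : ∀ n, M.Ω n → Mat (M.N n) (M.T n)} {Z : ∀ n, M.Ω n → Fin K → Mat (M.N n) (M.T n)}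

/-- The extreme values of c are harmless: for c = ∞ the conclusion is void, and for c = 0 the
infinite scaling factor forces x = 0. -/
lemma ofReal_le_of_scaled_le {x η ρ : ℝ} {c : ℝ≥0∞} (hx : 0 ≤ x) (hη : 0 < η) (hρ : 0 < ρ)
    (h : (ENNReal.ofReal ρ * c)⁻¹ * ‖x‖ₑ ≤ ENNReal.ofReal η) :
    ENNReal.ofReal x ≤ ENNReal.ofReal (η * ρ) * c := by
  rw [Real.enorm_eq_ofReal hx] at h
  have hη' : ENNReal.ofReal η ≠ 0 := by simpa using hη
  have hρ' : ENNReal.ofReal ρ ≠ 0 := by simpa using hρ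
  have h0 : ENNReal.ofReal (η * ρ) ≠ 0 := by
    simpa using mul_pos hη hρ
  rcases eq_or_ne c ⊤ with rfl | hc
  · rw [ENNReal.mul_top h0]
    exact le_top
  · rw [ENNReal.ofReal_mul hη.le, mul_assoc]
    rcases eq_or_ne c 0 with rfl | hc0
    · rw [mul_zero, ENNReal.inv_zero] at h
      rcases eq_or_ne (ENNReal.ofReal x) 0 with hx0 | hx0
      · rw [hx0]
        exact zero_le
      · rw [ENNReal.top_mul hx0] at h
        exact absurd (top_le_iff.1 h) ENNReal.ofReal_ne_top
    · rwa [mul_comm, ← div_eq_mul_inv, ENNReal.div_le_iff (mul_ne_zero hρ' hc0)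
        (ENNReal.mul_ne_top ENNReal.ofReal_ne_top hc)] at h

lemma gram_of_scaled_le {N T : ℕ} {Z : Fin K → Mat N T} {C ρ : ℝ} (hρ : 0 < ρ) (hC : 0 ≤ C)
    (h : ((ENNReal.ofReal ρ)⁻¹)⁻¹ * gramInvNorm Z ≤ ENNReal.ofReal C) :
    IsUnit (gram Z).det ∧ frobNorm (gram Z)⁻¹ ≤ C / ρ := by
  have hρ' : ENNReal.ofReal ρ ≠ 0 := by simpa using hρ
  rw [inv_inv, gramInvNorm] at h
  split_ifs at h with hu
  · rw [← ENNReal.ofReal_mul hρ.le, ENNReal.ofReal_le_ofReal_iff hC] at h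
    exact ⟨hu, (le_div_iff₀' hρ).2 h⟩
  · rw [ENNReal.mul_top hρ'] at h
    exact absurd (top_le_iff.1 h) ENNReal.ofReal_ne_top

/-- The maximal entries are little-o, so their slack may be chosen as a function of C; `entrySlack K
C` is the one that makes the candidate weight feasible. -/
lemma DecompositionWith.tight {π : ∀ n, ProbabilityMeasure (M.Ω n) → Fin K → ℝ}
    {H V : ∀ n, ProbabilityMeasure (M.Ω n) → M.Ω n → Mat (M.N n) (M.T n)}
    (h : M.DecompositionWith c X Z π H V) :
    M.Tight fun C n P _ ω => DecompBound C (entrySlack K C) (c n) (X n ω) (Z n ω) (π n P)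
      (H n P ω) (V n P ω) := by
  have hs := M.eventually_rootDim_pos
  have hm := M.eventually_maxDim_pos
  have hslack : ∀ C : ℝ, 1 ≤ C → 0 < entrySlack K C := fun C hC =>
    entrySlack_pos K (one_pos.trans_le hC)
  have t1 := tight_of_ae h.decomp
  have t2 := h.norm_V.1.tight_abs M.rootNT_eq hs
  have t3 := h.norm_V.tight_le M.rootNT_eq hs
  have t4 := h.sn_V.tight_abs M.maxRoot_eq hm
  have t5 := h.norm_H.tight_abs M.rootNT_eq hs
  have t6 := h.inner_H_V.tight_abs M.rootNT_eq hs
  have t7 := Tight.forall_fin fun k => (h.norm_Z k).tight_abs M.rootNT_eq hs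
  have t8 := Tight.forall_fin fun k => (h.inner_Z_V k).tight_abs M.rootNT_eq hs
  have t9 := h.gram_inv.tight
  have t10 := h.max_V.tight hslack
  have t11 := Tight.forall_fin fun k => (h.max_Z k).tight hslack
  refine (t1.and <| t2.and <| t3.and <| t4.and <| t5.and <| t6.and <| t7.and <| t8.and <|
    t9.and <| t10.and t11).mono fun C hC => hs.mono fun n hn P _ θ _ ω => ?_
  rintro ⟨e1, e2, e3, e4, e5, e6, e7, e8, e9, e10, e11⟩
  have hn2 : 0 < rootDim (M.N n) (M.T n) ^ 2 := by positivity
  rw [M.prodNT_eq] at e9 e10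
  simp only [M.prodNT_eq, ← ENNReal.ofReal_pow hn2.le] at e11
  rw [abs_of_nonneg (frobNorm_nonneg _)] at e2 e3 e5
  rw [abs_of_nonneg (sv_nonneg _ _)] at e4
  simp only [abs_of_nonneg (frobNorm_nonneg _)] at e7
  obtain ⟨g1, g2⟩ := gram_of_scaled_le hn2 (by linarith) e9
  exact ⟨e1, e2, e3, e4, e5, e6, e7, e8, g1, g2,
    ofReal_le_of_scaled_le (maxSq_nonneg _) (hslack C hC) hn2 e10,
    fun k => ofReal_le_of_scaled_le (maxSq_nonneg _) (hslack C hC) (by positivity) (e11 k)⟩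

end Decomposition

end PanelSeq

/-! ### Continuity, symmetry and quantiles of the normal distribution function. -/

section Gaussian

lemma continuous_cdf_gaussianReal : Continuous fun x => cdf (gaussianReal 0 1) x := by
  have : NullSingletonClass (gaussianReal 0 1) := nullSingletonClass_gaussianReal one_ne_zero
  refine continuous_iff_continuousAt.2 fun x => ?_
  rw [(monotone_cdf _).continuousAt_iff_leftLim_eq_rightLim, StieltjesFunction.rightLim_eq]
  have h1 := (cdf (gaussianReal 0 1)).measure_singleton x
  rw [measure_cdf, measure_singleton, eq_comm, ENNReal.ofReal_eq_zero] at h1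
  exact le_antisymm ((monotone_cdf _).leftLim_le le_rfl) (by linarith)

lemma cdf_gaussianReal_neg (x : ℝ) :
    cdf (gaussianReal 0 1) (-x) = 1 - cdf (gaussianReal 0 1) x := by
  have : NullSingletonClass (gaussianReal 0 1) := nullSingletonClass_gaussianReal one_ne_zero
  have h1 : (gaussianReal 0 1).map (fun x => -x) = gaussianReal 0 1 := by
    simpa using gaussianReal_map_neg (μ := 0) (v := 1)
  rw [cdf_eq_real, cdf_eq_real]
  have h2 : (gaussianReal 0 1).real (Set.Iic (-x)) = (gaussianReal 0 1).real (Set.Ici x) := by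
    nth_rewrite 1 [← h1]
    rw [map_measureReal_apply (by fun_prop) measurableSet_Iic]
    congr 1
    ext y
    simp
  rw [h2, measureReal_congr Ioi_ae_eq_Ici.symm, ← Set.compl_Iic,
    probReal_compl_eq_one_sub measurableSet_Iic]

lemma cdf_normalQuantile {p : ℝ} (h0 : 0 < p) (h1 : p < 1) :
    cdf (gaussianReal 0 1) (normalQuantile p) = p := by
  have hc := continuous_cdf_gaussianReal
  obtain ⟨a, ha⟩ := ((tendsto_cdf_atBot (gaussianReal 0 1)).eventually_lt_const h0).exists
  obtain ⟨b, hb⟩ := ((tendsto_cdf_atTop (gaussianReal 0 1)).eventually_const_lt h1).exists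
  obtain ⟨x, hx⟩ : p ∈ Set.range fun x => cdf (gaussianReal 0 1) x :=
    mem_range_of_exists_le_of_exists_ge hc ⟨a, ha.le⟩ ⟨b, hb.le⟩
  have hbdd : BddBelow {x : ℝ | p ≤ cdf (gaussianReal 0 1) x} := by
    refine ⟨a, fun y hy => ?_⟩
    by_contra! hya
    exact absurd (hy.trans (monotone_cdf _ hya.le)) (not_le.2 ha)
  have hmem : normalQuantile p ∈ {x : ℝ | p ≤ cdf (gaussianReal 0 1) x} :=
    -- By continuity the superlevel set is closed, so the infimum defining the quantile is attained.
    (isClosed_le continuous_const hc).csInf_mem ⟨x, hx.ge⟩ hbdd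
  exact le_antisymm ((monotone_cdf _ (csInf_le hbdd hx.ge)).trans hx.le) hmem

end Gaussian

namespace PanelSeq

variable {K R : ℕ} {M : PanelSeq K} {c : ℕ → ℝ≥0∞}

/-! ### Measurability of the estimators. -/

section Measurability

variable {α : Type*} [MeasurableSpace α] {N T : ℕ}

lemma measurable_matrix_iff {f : α → Mat N T} :
    Measurable f ↔ ∀ i t, Measurable fun x => f x i t :=
  measurable_pi_iff.trans (forall_congr' fun _ => measurable_pi_iff)

lemma measurable_frobInner {f g : α → Mat N T} (hf : Measurable f) (hg : Measurable g) :
    Measurable fun x => frobInner (f x) (g x) :=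
  Finset.measurable_sum _ fun i _ => Finset.measurable_sum _ fun t _ =>
    (measurable_matrix_iff.1 hf i t).mul (measurable_matrix_iff.1 hg i t)

lemma measurable_matrix_add {f g : α → Mat N T} (hf : Measurable f) (hg : Measurable g) :
    Measurable fun x => f x + g x :=
  measurable_matrix_iff.2 fun i t =>
    (measurable_matrix_iff.1 hf i t).add (measurable_matrix_iff.1 hg i t)

lemma measurable_matrix_sub {f g : α → Mat N T} (hf : Measurable f) (hg : Measurable g) :
    Measurable fun x => f x - g x :=
  measurable_matrix_iff.2 fun i t =>
    (measurable_matrix_iff.1 hf i t).sub (measurable_matrix_iff.1 hg i t)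

lemma measurable_lin {X : α → Mat N T} {Z : α → Fin K → Mat N T} {g : α → ℝ × (Fin K → ℝ)}
    (hX : Measurable X) (hZ : Measurable Z) (hg : Measurable g) :
    Measurable fun x => lin (X x) (Z x) (g x) := by
  refine measurable_matrix_iff.2 fun i t => ?_
  simp only [lin, Matrix.add_apply, Matrix.sum_apply, Matrix.smul_apply, smul_eq_mul]
  refine (hg.fst.mul (measurable_matrix_iff.1 hX i t)).add (Finset.measurable_sum _ fun k _ => ?_)
  exact ((measurable_pi_iff.1 hg.snd) k).mul
    (measurable_matrix_iff.1 ((measurable_pi_iff.1 hZ) k) i t)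

lemma measurable_update_controls {X : α → Mat N T} {Z : α → Fin K → Mat N T}
    (hX : Measurable X) (hZ : Measurable Z) (j : Fin K) :
    Measurable fun x => Function.update (Z x) j (X x) := by
  refine measurable_pi_iff.2 fun k => ?_
  rcases eq_or_ne k j with rfl | hk
  · simpa using hX
  · simp only [Function.update_of_ne hk]
    exact measurable_pi_iff.1 hZ k

lemma measurable_Y (M : PanelSeq K) (n : ℕ) (θ : ℝ × (Fin K → ℝ)) : Measurable (M.Y n θ) :=
  measurable_matrix_add (measurable_matrix_add
    (measurable_lin (M.measurable_X n) (M.measurable_Z n) measurable_const) (M.measurable_Gam n))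
    (M.measurable_U n)

/-- Lets the algorithm's standard error be treated as a case of a general measurable one. -/
lemma measurable_se {c : ℝ≥0∞} (I : Implementation N T K R c) :
    Measurable fun d : Mat N T × Mat N T × (Fin K → Mat N T) => I.se d.1 d.2.1 d.2.2 := by
  have hY : Measurable fun d : Mat N T × Mat N T × (Fin K → Mat N T) => d.1 := measurable_fst
  have hX : Measurable fun d : Mat N T × Mat N T × (Fin K → Mat N T) => d.2.1 :=
    measurable_snd.fst
  have hZ : Measurable fun d : Mat N T × Mat N T × (Fin K → Mat N T) => d.2.2 :=
    measurable_snd.snd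
  have hA : Measurable fun d : Mat N T × Mat N T × (Fin K → Mat N T) => I.weight d.2.1 d.2.2 :=
    I.measurable_weight.comp (hX.prodMk hZ)
  have hE : Measurable fun d : Mat N T × Mat N T × (Fin K → Mat N T) =>
      d.1 - I.gammaLS d.1 d.2.1 d.2.2 := measurable_matrix_sub hY I.measurable_ls.snd
  have hcoef : Measurable fun d : Mat N T × Mat N T × (Fin K → Mat N T) =>
      I.coefPre d.1 d.2.1 d.2.2 := by
    refine (measurable_frobInner hA hE).prodMk (measurable_pi_iff.2 fun j => ?_)
    refine measurable_frobInner ?_ hE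
    exact I.measurable_weight.comp
      ((measurable_pi_iff.1 hZ j).prodMk (measurable_update_controls hX hZ j))
  have hfit := measurable_matrix_sub hY (measurable_lin hX hZ hcoef)
  have hres := measurable_matrix_sub hfit (I.measurable_lowRank.comp hfit)
  refine Measurable.sqrt ?_
  exact Finset.measurable_sum _ fun i _ => Finset.measurable_sum _ fun t _ =>
    ((measurable_matrix_iff.1 hA i t).pow_const 2).mul
      ((measurable_matrix_iff.1 hres i t).pow_const 2)

end Measurability

/-! ### The deterministic bounds hold with high probability. -/

section Events

lemma norm_le_of_decompBound_fin_zero {N T : ℕ} {C η : ℝ} {c : ℝ≥0∞} {X H V : Mat N T}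
    {Z : Fin 0 → Mat N T} {π : Fin 0 → ℝ} (h : DecompBound C η c X Z π H V) :
    frobNorm X ≤ 2 * C * rootDim N T := by
  rw [h.decomp, Finset.univ_eq_empty, Finset.sum_empty, zero_add]
  linarith [frobNorm_add_le H V, h.norm_H, h.norm_V]

/-- The factor model bounds only the spectral norm of X. If there is a control, X is itself a
control in the interchanged decomposition, where its Frobenius norm is bounded; if K = 0, then X = H
+ V. -/
lemma tight_frobNorm_X (hX : M.Decomposition c M.X M.Z)
    (hZ : ∀ k : Fin K, M.Decomposition c (fun n ω => M.Z n ω k)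
      (fun n ω => Function.update (M.Z n ω) k (M.X n ω))) :
    M.Tight fun C n _ _ ω => frobNorm (M.X n ω) ≤ C * rootDim (M.N n) (M.T n) := by
  rcases Nat.eq_zero_or_pos K with rfl | hK
  · obtain ⟨π, H, V, h⟩ := hX
    refine h.tight.mono_const (fun C => 2 * C) fun C _ C' hC' =>
      M.eventually_rootDim_pos.mono fun n hn P _ θ _ ω hω => ?_
    exact (norm_le_of_decompBound_fin_zero hω).trans (mul_le_mul_of_nonneg_right hC' hn.le)
  · obtain ⟨π, H, V, h⟩ := hZ ⟨0, hK⟩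
    refine h.tight.mono fun C _ => Eventually.of_forall fun n P _ θ _ ω hω => ?_
    simpa using hω.norm_Z ⟨0, hK⟩

lemma FactorModel.tight_noise (h : M.FactorModel R)
    {A : ∀ n, Mat (M.N n) (M.T n) → (Fin K → Mat (M.N n) (M.T n)) → Mat (M.N n) (M.T n)}
    (hA : ∀ n, Measurable fun d : Mat (M.N n) (M.T n) × (Fin K → Mat (M.N n) (M.T n)) =>
      A n d.1 d.2) :
    M.Tight fun C n _ _ ω => |frobInner (A n (M.X n ω) (M.Z n ω)) (M.U n ω)| ≤
      C * frobNorm (A n (M.X n ω) (M.Z n ω)) := by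
  refine ((h.inner_U A hA).tight_abs (ρ := fun _ => 1) (by simp) (by simp)).mono
    fun C hC => Eventually.of_forall fun n P _ θ _ ω hω => ?_
  -- The assumption concerns a quotient that is 0 by convention when A = 0; there the bound follows
  -- from Cauchy–Schwarz.
  rcases (frobNorm_nonneg (A n (M.X n ω) (M.Z n ω))).eq_or_lt with h0 | h0
  · have := abs_frobInner_le (A n (M.X n ω) (M.Z n ω)) (M.U n ω)
    rw [← h0, zero_mul] at this
    rwa [← h0, mul_zero]
  · rwa [abs_div, abs_of_pos h0, mul_one, div_le_iff₀ h0] at hω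

lemma FactorModel.tight_modelBound (h : M.FactorModel R) (hX : M.Decomposition c M.X M.Z)
    (hZ : ∀ k : Fin K, M.Decomposition c (fun n ω => M.Z n ω k)
      (fun n ω => Function.update (M.Z n ω) k (M.X n ω))) {η : ℝ} (hη : 0 < η) :
    ∃ s, 0 < s ∧ M.Tight fun C n _ _ ω =>
      ModelBound R C s η (M.X n ω) (M.Z n ω) (M.Gam n ω) (M.U n ω) := by
  obtain ⟨s, hs, hnc⟩ := h.nonCollinear
  refine ⟨s, hs, ?_⟩
  have hr := M.eventually_rootDim_pos
  have hm := M.eventually_maxDim_pos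
  have t1 := tight_of_ae h.rank_le
  have t2 : M.Tight fun _ n _ _ ω => NonCollinear R s (M.X n ω) (M.Z n ω) := tight_of_tendsto hnc
  have t3 := tight_frobNorm_X hX hZ
  obtain ⟨π, H, V, hd⟩ := hX
  have t4 := Tight.forall_fin fun k => (hd.norm_Z k).tight_abs M.rootNT_eq hr
  have t5 := h.ex_X.tight_abs M.rootNT_eq hr
  have t6 := Tight.forall_fin fun k => (h.ex_Z k).tight_abs M.rootNT_eq hr
  have t7 := h.sn_U.1.tight_abs M.maxRoot_eq hm
  have t8 := h.sn_U.tight_le M.maxRoot_eq hm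
  have t9 := (h.sv_U (2 * R + 1) (by omega)).tight (η := fun _ => η) fun _ _ => hη
  refine (t1.and <| t2.and <| t3.and <| t4.and <| t5.and <| t6.and <| t7.and <| t8.and t9).mono
    fun C hC => hm.mono fun n hn P _ θ _ ω => ?_
  rintro ⟨e1, e2, e3, e4, e5, e6, e7, e8, e9⟩
  simp only [abs_of_nonneg (frobNorm_nonneg _)] at e4
  rw [abs_of_nonneg (sv_nonneg _ _)] at e7 e8
  refine ⟨e1, e2, e3, e4, e5, e6, e7, e8, ?_⟩
  -- Strict positivity, from the lower bound on s_1(U), makes the relative gap a genuine quotient.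
  have hU : 0 < sv (M.U n ω) 1 := by
    by_contra! h0
    nlinarith
  rw [Pi.one_apply, inv_one, one_mul, Real.enorm_eq_ofReal_abs,
    ENNReal.ofReal_le_ofReal_iff hη.le] at e9
  exact (div_le_iff₀ hU).1 ((le_abs_self _).trans e9)

/-- The candidate shows feasibility, so the pick, arbitrary on infeasible data, is optimal here and
inherits the order of the candidate. -/
lemma weightBound_of_decompBound {N T : ℕ} {C : ℝ} (hC : 1 ≤ C) {c : ℝ≥0∞} {X : Mat N T}
    {Z : Fin K → Mat N T} {π : Fin K → ℝ} {H V U : Mat N T} (I : Implementation N T K R c)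
    (h : DecompBound C (entrySlack K C) c X Z π H V)
    (hN : 0 < N) (hT : 0 < T) (hdim : weightDim K C ≤ rootDim N T)
    (hU : |frobInner (I.weight X Z) U| ≤ C * frobNorm (I.weight X Z)) :
    Feasible c X Z (I.weight X Z) ∧
      WeightBound R C (weightConst K C * (1 + 8 * R)) U (I.weight X Z) := by
  obtain ⟨B, hB, h1, h2⟩ := h.exists_feasible hC hN hT hdim
  have hopt := I.weight_optimal X Z ⟨B, hB⟩
  obtain ⟨h3, h4⟩ := hopt.norm_le (weightConst_pos K (one_pos.trans_le hC)) hN hT hB h1 h2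
  exact ⟨hopt.1, h3, h4, hU⟩

/-- With high probability, `β̂` has the stated rate and its bias is covered. -/
lemma FactorModel.tight_betaHat (h : M.FactorModel R)
    (I : ∀ n, Implementation (M.N n) (M.T n) K R (c n)) (hX : M.Decomposition c M.X M.Z)
    (hZ : ∀ k : Fin K, M.Decomposition c (fun n ω => M.Z n ω k)
      (fun n ω => Function.update (M.Z n ω) k (M.X n ω))) {ε : ℝ} (hε : 0 < ε) :
    M.Tight fun C n _ θ ω =>
      |(I n).betaHat (M.Y n θ ω) (M.X n ω) (M.Z n ω) - θ.1| ≤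
        C / minDim (M.N n) (M.T n) ^ 2 ∧
      |(I n).betaHat (M.Y n θ ω) (M.X n ω) (M.Z n ω) - θ.1 -
          frobInner ((I n).weight (M.X n ω) (M.Z n ω)) (M.U n ω)| ≤
        (I n).biasBar ε (M.Y n θ ω) (M.X n ω) (M.Z n ω) := by
  obtain ⟨s, hs, t1⟩ := h.tight_modelBound hX hZ (η := ε / (3 + 2 * ε)) (by positivity)
  have t2 := h.tight_noise (A := fun n => (I n).weight) fun n => (I n).measurable_weight
  -- The switched weights are measurable functions of (X, Z) too, so the same noise assumption
  -- applies to them.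
  have t3 := Tight.forall_fin fun j : Fin K =>
    h.tight_noise (A := fun n X Z => (I n).weight (Z j) (Function.update Z j X)) fun n =>
      (I n).measurable_weight.comp (f := fun d : Mat (M.N n) (M.T n) ×
        (Fin K → Mat (M.N n) (M.T n)) => (d.2 j, Function.update d.2 j d.1))
        ((measurable_pi_iff.1 measurable_snd j).prodMk
          (measurable_update_controls measurable_fst measurable_snd j))
  obtain ⟨π, H, V, hd⟩ := hX
  choose π' H' V' hd' using hZ
  have t5 := Tight.forall_fin fun j => (hd' j).tight
  refine (t1.and <| t2.and <| t3.and <| hd.tight.and t5).mono_const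
    (fun C => (C + fitConst K R C s (weightConst K C * (1 + 8 * R))) *
      (weightConst K C * (1 + 8 * R)) + C * (weightConst K C * (1 + 8 * R)))
    fun C hC C' hC' => ?_
  have hC0 : 0 < C := one_pos.trans_le hC
  have hL : 0 ≤ weightConst K C * (1 + 8 * R) := by
    have := weightConst_pos K hC0
    positivity
  filter_upwards [M.eventually_pos, M.eventually_le_rootDim (weightDim K C),
    M.tendsto_minDim.eventually_ge_atTop (fitConst K R C s (weightConst K C * (1 + 8 * R)) * C /
      (ε / (3 + 2 * ε)))] with n hn hdim hmin P _ θ _ ω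
  rintro ⟨e1, e2, e3, e4, e5⟩
  obtain ⟨hf, hw⟩ := weightBound_of_decompBound hC (I n) e4 hn.1 hn.2 hdim e2
  have hfw := fun j => weightBound_of_decompBound hC (I n) (e5 j) hn.1 hn.2 hdim (e3 j)
  refine ⟨?_, (I n).abs_betaHat_error_sub_noise_le_biasBar hε e1 hC0 hs hL hn.1 hn.2 θ hf hw
    (fun j => (hfw j).1) (fun j => (hfw j).2) hmin⟩
  refine ((I n).abs_betaHat_error_le e1 hC0.le hs hL hn.1 hn.2 θ hf hw
    (fun j => (hfw j).1) (fun j => (hfw j).2)).trans ?_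
  gcongr

end Events

/-! ### From asymptotic normality to coverage. -/

section Coverage

lemma NoiseNormal.eventually {I : ∀ n, Implementation (M.N n) (M.T n) K R (c n)}
    {se : ∀ n, Mat (M.N n) (M.T n) → Mat (M.N n) (M.T n) → (Fin K → Mat (M.N n) (M.T n)) → ℝ}
    (h : M.NoiseNormal I se) (t : ℝ) {δ : ℝ} (hδ : 0 < δ) :
    ∀ᶠ n in atTop, ∀ P ∈ M.Pr n, ∀ θ ∈ M.Par n,
      |(P : Measure (M.Ω n)).real {ω | frobInner ((I n).weight (M.X n ω) (M.Z n ω)) (M.U n ω) /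
        se n (M.Y n θ ω) (M.X n ω) (M.Z n ω) ≤ t} - cdf (gaussianReal 0 1) t| ≤ δ := by
  refine ((h t).eventually_lt_const (ENNReal.ofReal_pos.2 hδ)).mono fun n hn P hP θ hθ => ?_
  have h1 := (le_iSup₂ (f := fun θ (_ : θ ∈ M.Par n) => ENNReal.ofReal
    |(P : Measure (M.Ω n)).real {ω | frobInner ((I n).weight (M.X n ω) (M.Z n ω)) (M.U n ω) /
      se n (M.Y n θ ω) (M.X n ω) (M.Z n ω) ≤ t} - cdf (gaussianReal 0 1) t|) θ hθ).trans
    (le_iSup₂ (f := fun (P : ProbabilityMeasure (M.Ω n)) (_ : P ∈ M.Pr n) =>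
      ⨆ θ ∈ M.Par n, ENNReal.ofReal |(P : Measure (M.Ω n)).real
        {ω | frobInner ((I n).weight (M.X n ω) (M.Z n ω)) (M.U n ω) /
          se n (M.Y n θ ω) (M.X n ω) (M.Z n ω) ≤ t} - cdf (gaussianReal 0 1) t|) P hP)
  exact (ENNReal.ofReal_le_ofReal_iff hδ.le).1 (h1.trans hn.le)

/-- Coverage of a symmetric interval around zero by an approximately normal ratio; the denominator
may vanish, in which case the ratio is zero. -/
lemma le_real_of_ratio_near_normal {Ω : Type*} [MeasurableSpace Ω] {μ : Measure Ω}
    [IsProbabilityMeasure μ] {a d : Ω → ℝ} (had : Measurable fun ω => a ω / d ω)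
    (hd : ∀ ω, 0 ≤ d ω) {z x δ : ℝ} {E B : Set Ω} (hB : μ.real B ≤ δ)
    (hE : ∀ ω, |a ω| ≤ z * d ω → ω ∉ B → ω ∈ E)
    (h : ∀ t ∈ ({z, -z, 0, -x} : Set ℝ),
      |μ.real {ω | a ω / d ω ≤ t} - cdf (gaussianReal 0 1) t| ≤ δ)
    (hx : 0 < x) (hxδ : cdf (gaussianReal 0 1) 0 - cdf (gaussianReal 0 1) (-x) ≤ δ) :
    cdf (gaussianReal 0 1) z - cdf (gaussianReal 0 1) (-z) - 6 * δ ≤ μ.real E := by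
  have h1 := (abs_le.1 (h z (by simp))).1
  have h2 := (abs_le.1 (h (-z) (by simp))).2
  have h3 := (abs_le.1 (h 0 (by simp))).2
  have h4 := (abs_le.1 (h (-x) (by simp))).1
  -- Where d = 0 the ratio is 0 and lies in (-x, 0]. The normal law gives this window mass at most
  -- δ, so d = 0 has probability at most 3δ.
  have h5 : μ.real {ω | d ω = 0} + μ.real {ω | a ω / d ω ≤ -x} ≤ μ.real {ω | a ω / d ω ≤ 0} := by
    rw [← measureReal_union _ (measurableSet_le had measurable_const)]
    · refine measureReal_mono ?_
      rintro ω (hω | hω)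
      · simp only [Set.mem_ofPred_eq] at hω ⊢
        simp [hω]
      · exact le_trans (b := -x) hω (by linarith)
    · refine Set.disjoint_left.2 fun ω hω hω' => ?_
      simp only [Set.mem_ofPred_eq] at hω hω'
      rw [hω, div_zero] at hω'
      linarith
  have h6 : μ.real {ω | a ω / d ω ≤ z} ≤
      μ.real E + (μ.real {ω | a ω / d ω ≤ -z} + (μ.real {ω | d ω = 0} + μ.real B)) := by
    refine le_trans (measureReal_mono
      (s₂ := E ∪ ({ω | a ω / d ω ≤ -z} ∪ ({ω | d ω = 0} ∪ B))) fun ω hω => ?_) ?_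
    · by_contra hn
      simp only [Set.mem_union, not_or, Set.mem_ofPred_eq, not_le] at hn hω
      obtain ⟨n1, n2, n3, n4⟩ := hn
      have hd0 : 0 < d ω := (hd ω).lt_of_ne' n3
      refine n1 (hE ω ?_ n4)
      have e : |a ω| = |a ω / d ω| * d ω := by
        rw [abs_div, abs_of_pos hd0, div_mul_cancel₀ _ hd0.ne']
      rw [e]
      exact mul_le_mul_of_nonneg_right (abs_le.2 ⟨n2.le, hω⟩) hd0.le
    · refine (measureReal_union_le _ _).trans (add_le_add le_rfl ?_)
      refine (measureReal_union_le _ _).trans (add_le_add le_rfl ?_)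
      exact measureReal_union_le _ _
  -- Total loss 6δ: one each for z and -z, three for d = 0, one for B.
  linarith

end Coverage

/-- Validity of the bias-aware confidence interval. -/
lemma FactorModel.validCI (h : M.FactorModel R)
    (I : ∀ n, Implementation (M.N n) (M.T n) K R (c n)) (hX : M.Decomposition c M.X M.Z)
    (hZ : ∀ k : Fin K, M.Decomposition c (fun n ω => M.Z n ω k)
      (fun n ω => Function.update (M.Z n ω) k (M.X n ω))) {ε α : ℝ} (hε : 0 < ε)
    (hα0 : 0 < α) (hα1 : α < 1)
    {se : ∀ n, Mat (M.N n) (M.T n) → Mat (M.N n) (M.T n) → (Fin K → Mat (M.N n) (M.T n)) → ℝ}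
    (hse : ∀ n, Measurable fun d : Mat (M.N n) (M.T n) × Mat (M.N n) (M.T n) ×
      (Fin K → Mat (M.N n) (M.T n)) => se n d.1 d.2.1 d.2.2)
    (hse0 : ∀ n Y X Z, 0 ≤ se n Y X Z) (hnormal : M.NoiseNormal I se) : M.ValidCI I ε α se := by
  set z := normalQuantile (1 - α / 2) with hz
  have hΦ : cdf (gaussianReal 0 1) z - cdf (gaussianReal 0 1) (-z) = 1 - α := by
    rw [cdf_gaussianReal_neg, hz, cdf_normalQuantile (by linarith) (by linarith)]
    ring
  refine ENNReal.le_of_forall_pos_le_add fun δ' hδ' _ => ?_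
  set δ : ℝ := δ' / 6
  have hδ : 0 < δ := by
    have : (0 : ℝ) < δ' := by exact_mod_cast hδ'
    positivity
  obtain ⟨x, hx, hxδ⟩ : ∃ x : ℝ, 0 < x ∧
      cdf (gaussianReal 0 1) 0 - cdf (gaussianReal 0 1) (-x) ≤ δ := by
    have hc : Tendsto (fun x => cdf (gaussianReal 0 1) 0 - cdf (gaussianReal 0 1) (-x))
        (𝓝[>] 0) (𝓝 0) := by
      have h1 : Tendsto (fun x => cdf (gaussianReal 0 1) 0 - cdf (gaussianReal 0 1) (-x)) (𝓝 0)
          (𝓝 (cdf (gaussianReal 0 1) 0 - cdf (gaussianReal 0 1) (-0))) :=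
        (continuous_const.sub (continuous_cdf_gaussianReal.comp continuous_neg)).tendsto 0
      rw [neg_zero, sub_self] at h1
      exact h1.mono_left nhdsWithin_le_nhds
    obtain ⟨x, hx1, hx2⟩ := ((hc.eventually_lt_const hδ).and self_mem_nhdsWithin).exists
    exact ⟨x, hx2, hx1.le⟩
  obtain ⟨C, hC⟩ := h.tight_betaHat I hX hZ hε (ENNReal.ofReal δ) (ENNReal.ofReal_pos.2 hδ)
  rw [← tsub_le_iff_right]
  refine le_liminf_of_le (by isBoundedDefault) ?_
  filter_upwards [hC C le_rfl, hnormal.eventually z hδ, hnormal.eventually (-z) hδ,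
    hnormal.eventually 0 hδ, hnormal.eventually (-x) hδ] with n n1 n2 n3 n4 n5
  refine le_iInf₂ fun P hP => le_iInf₂ fun θ hθ => ?_
  have hYm := measurable_Y M n θ
  have hcov := le_real_of_ratio_near_normal (μ := (P : Measure (M.Ω n)))
    (a := fun ω => frobInner ((I n).weight (M.X n ω) (M.Z n ω)) (M.U n ω))
    (d := fun ω => se n (M.Y n θ ω) (M.X n ω) (M.Z n ω)) (z := z)
    (B := {ω | ¬ (_ ∧ _)})
    (E := {ω | θ.1 ∈ Set.Icc
      ((I n).betaHat (M.Y n θ ω) (M.X n ω) (M.Z n ω) -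
        ((I n).biasBar ε (M.Y n θ ω) (M.X n ω) (M.Z n ω) +
          z * se n (M.Y n θ ω) (M.X n ω) (M.Z n ω)))
      ((I n).betaHat (M.Y n θ ω) (M.X n ω) (M.Z n ω) +
        ((I n).biasBar ε (M.Y n θ ω) (M.X n ω) (M.Z n ω) +
          z * se n (M.Y n θ ω) (M.X n ω) (M.Z n ω)))})
    ((measurable_frobInner ((I n).measurable_weight.comp
      ((M.measurable_X n).prodMk (M.measurable_Z n))) (M.measurable_U n)).div
      ((hse n).comp (hYm.prodMk ((M.measurable_X n).prodMk (M.measurable_Z n)))))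
    (fun ω => hse0 n _ _ _) (ENNReal.toReal_le_of_le_ofReal hδ.le (n1 P hP θ hθ)) ?_ ?_ hx hxδ
  · rw [hΦ, show 6 * δ = δ' by simp only [δ]; ring] at hcov
    rw [← ENNReal.ofReal_coe_nnreal, ← ENNReal.ofReal_sub _ δ'.coe_nonneg, ← ofReal_measureReal]
    exact ENNReal.ofReal_le_ofReal hcov
  -- Off the bad event |β̂ - β| ≤ |⟨A*, U⟩| + worst-case bias, and |⟨A*, U⟩| ≤ z se.
  · intro ω hω hB
    have hb := (not_not.1 hB).2
    have h1 := abs_le.1 hω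
    have h2 := abs_le.1 hb
    exact ⟨by linarith, by linarith⟩
  · rintro t (rfl | rfl | rfl | rfl)
    exacts [n2 P hP θ hθ, n3 P hP θ hθ, n4 P hP θ hθ, n5 P hP θ hθ]

/-- The rate of `β̂`. -/
lemma FactorModel.bigO_betaHat (h : M.FactorModel R)
    (I : ∀ n, Implementation (M.N n) (M.T n) K R (c n)) (hX : M.Decomposition c M.X M.Z)
    (hZ : ∀ k : Fin K, M.Decomposition c (fun n ω => M.Z n ω k)
      (fun n ω => Function.update (M.Z n ω) k (M.X n ω))) :
    M.BigO (fun n _ θ ω => ‖(I n).betaHat (M.Y n θ ω) (M.X n ω) (M.Z n ω) - θ.1‖ₑ)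
      (fun n => ((min (M.N n) (M.T n) : ℕ) : ℝ≥0∞)⁻¹) := by
  intro δ hδ
  obtain ⟨C₀, hC₀⟩ := h.tight_betaHat I hX hZ one_pos δ (by exact_mod_cast hδ)
  set C := max C₀ 0
  have hC0 : 0 ≤ C := le_max_right _ _
  -- The event in `BigO` has a non-strict inequality; C + 1 in place of C makes it incompatible with
  -- the bound by C.
  refine ⟨⟨C + 1, by positivity⟩, limsup_le_of_le (by isBoundedDefault) ?_⟩
  filter_upwards [hC₀ C (le_max_left _ _), M.eventually_pos] with n hn hpos
  refine iSup₂_le fun P hP => iSup₂_le fun θ hθ => le_trans (measure_mono ?_) (hn P hP θ hθ)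
  intro ω hω hq
  have hmin : (0 : ℝ) < (min (M.N n) (M.T n) : ℕ) := by exact_mod_cast lt_min hpos.1 hpos.2
  have h1 := hq.1
  rw [minDim_sq, le_div_iff₀ hmin] at h1
  have h2 : ENNReal.ofReal (C + 1) ≤ (((min (M.N n) (M.T n) : ℕ) : ℝ≥0∞)⁻¹)⁻¹ *
      ‖(I n).betaHat (M.Y n θ ω) (M.X n ω) (M.Z n ω) - θ.1‖ₑ := by
    rw [ENNReal.ofReal_eq_coe_nnreal (by positivity)]
    exact hω
  rw [inv_inv, Real.enorm_eq_ofReal_abs, ← ENNReal.ofReal_natCast,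
    ← ENNReal.ofReal_mul hmin.le, ENNReal.ofReal_le_ofReal_iff (by positivity)] at h2
  linarith

end PanelSeq

end FactorPanel

theorem mainTheorem3 {K : ℕ} (R : ℕ) (M : FactorPanel.PanelSeq K) (c : ℕ → ℝ≥0∞)
    (I : ∀ n, FactorPanel.Implementation (M.N n) (M.T n) K R (c n))
    (hfactor : M.FactorModel R)
    (hX : M.Decomposition c M.X M.Z)
    (hZ : ∀ k : Fin K, M.Decomposition c (fun n ω => M.Z n ω k)
      (fun n ω => Function.update (M.Z n ω) k (M.X n ω))) :
    M.BigO (fun n _ θ ω => ‖(I n).betaHat (M.Y n θ ω) (M.X n ω) (M.Z n ω) - θ.1‖ₑ)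
      (fun n => ((min (M.N n) (M.T n) : ℕ) : ℝ≥0∞)⁻¹) ∧
    ∀ ε α : ℝ, 0 < ε → 0 < α → α < 1 →
      (M.NoiseNormal I (fun n => (I n).se) → M.ValidCI I ε α (fun n => (I n).se)) ∧
      ∀ se : ∀ n, FactorPanel.Mat (M.N n) (M.T n) → FactorPanel.Mat (M.N n) (M.T n) →
          (Fin K → FactorPanel.Mat (M.N n) (M.T n)) → ℝ,
        (∀ n, Measurable fun d : FactorPanel.Mat (M.N n) (M.T n) ×
          FactorPanel.Mat (M.N n) (M.T n) × (Fin K → FactorPanel.Mat (M.N n) (M.T n)) =>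
          se n d.1 d.2.1 d.2.2) →
        (∀ n Y X Z, 0 ≤ se n Y X Z) →
        M.NoiseNormal I se → M.ValidCI I ε α se := by
  refine ⟨hfactor.bigO_betaHat I hX hZ, fun ε α hε hα0 hα1 => ⟨fun h => ?_, ?_⟩⟩
  · exact hfactor.validCI I hX hZ hε hα0 hα1
      (fun n => FactorPanel.PanelSeq.measurable_se (I n)) (fun _ _ _ _ => Real.sqrt_nonneg _) h
  · exact fun se hse hse0 h => hfactor.validCI I hX hZ hε hα0 hα1 hse hse0 h
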